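/- Let $k\ge 1$. A $k$-graph is a countable category $\Lambda$ with object set $\Lambda^0$ (the vertices), whose morphisms $\lambda$ are regarded as paths with range $r(\lambda)$ and source $s(\lambda)$ (so that $\lambda\mu$ is defined when $s(\lambda)=r(\mu)$), together with a functor $d:\Lambda\to\mathbb N^k$ such that whenever $d(\lambda)=m+n$ there are unique $\mu,\nu$ with $\lambda=\mu\nu$, $d(\mu)=m$, $d(\nu)=n$. The vertices are identified with the identity morphisms, i.e. the paths of degree $0$. For $v,w\in\Lambda^0$ and $n\in\mathbb N^k$ write $v\Lambda w$ for the set of paths with range $v$ and source $w$, $v\Lambda^n$ for the set of paths of degree $n$ with range $v$, and $$\Lambda^{\le n}=\{\lambda\in\Lambda: d(\lambda)\le n,\ \text{and } s(\lambda)\Lambda^{e_i}=\emptyset \text{ whenever } d(\lambda)+e_i\le n\},\qquad v\Lambda^{\le n}=\{\lambda\in\Lambda^{\le n}: r(\lambda)=v\},$$ where $e_1,\dots,e_k$ are the standard generators of $\mathbb N^k$. The $k$-graph $\Lambda$ is row-finite if every $v\Lambda^n$ is finite. It is locally convex if for all $v\in\Lambda^0$, all $i\ne j$, all $\lambda\in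 v\Lambda^{e_i}$ and all $\mu\in v\Lambda^{e_j}$, both $s(\lambda)\Lambda^{e_j}$ and $s(\mu)\Lambda^{e_i}$ are nonempty. For a unital commutative ring $R$ and a row-finite locally convex $\Lambda$, the Kumjian–Pask algebra $\mathrm{KP}_R(\Lambda)$ is the universal (not necessarily unital) associative $R$-algebra generated by elements $p_v$ ($v\in\Lambda^0$) and $s_\lambda, s_{\lambda^*}$ ($\lambda\in\Lambda$, $d(\lambda)\neq0$), with the convention $s_v=s_{v^*}=p_v$ for vertices $v$, subject to: (KP1) the $p_v$ are mutually orthogonal idempotents; (KP2) for $\lambda,\mu$ of nonzero degree with $r(\mu)=s(\lambda)$: $s_\lambda s_\mu=s_{\lambda\mu}$, $s_{\mu^*}s_{\lambda^*}=s_{(\lambda\mu)^*}$, and for every $\lambda$ of nonzero degree: $p_{r(\lambda)}s_\lambda=s_\lambda=s_\lambda p_{s(\lambda)}$, $p_{s(\lambda)}s_{\lambda^*}=s_{\lambda^*}=s_{\lambda^*}p_{r(\lambda)}$; (KP3) for $n\in\mathbb N^k\setminus\{0\}$ and $\lambda,\mu\in\Lambda^{\le n}$: $s_{\lambda^*}s_\mu=\delta_{\lambda,\mu}\,p_{s(\lambda)}$;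 (KP4) for $v\in\Lambda^0$ and $n\in\mathbb N^k\setminus\{0\}$: $p_v=\sum_{\lambda\in v\Lambda^{\le n}}s_\lambda s_{\lambda^*}$. A ring $A$ (not necessarily unital) is prime if $A\ne 0$ and, for all two-sided ideals $I,J$ of $A$ with $IJ=0$, $I=0$ or $J=0$. **Theorem.** Let $\Lambda$ be a row-finite locally convex $k$-graph, possibly with sources, with $\Lambda^0\neq\emptyset$, and let $R$ be a unital commutative ring. Then $\mathrm{KP}_R(\Lambda)$ is prime if and only if $R$ is an integral domain and $\Lambda^0$ satisfies (MT3): for all $v_1,v_2\in\Lambda^0$ there is $w\in\Lambda^0$ with $v_1\Lambda w\ne\emptyset$ and $v_2\Lambda w\neq\emptyset$. -/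

import Mathlib

open CategoryTheory

universe u v w z

/-- A `k`-graph structure on a category `Λ`. The objects of `Λ` are the vertices, and a morphism
`f : y ⟶ x` is a path with source `y` and range `x`. The path written `λμ` (with `s(λ) = r(μ)`) is
the composite `λ ∘ μ`, which is `μ ≫ λ` in Mathlib's notation. -/
structure HigherRankGraph (k : ℕ) (Λ : Type u) [Category.{v} Λ] where
  /-- the degree map -/
  degree : ∀ {y x : Λ}, (y ⟶ x) → Fin k → ℕ
  degree_id : ∀ x : Λ, degree (𝟙 x) = 0
  degree_comp : ∀ {z y x : Λ} (g : z ⟶ y) (f : y ⟶ x), degree (g ≫ f) = degree f + degree g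
  /-- the factorization property: if `d(h) = m + n` then `h = fg` with `d(f) = m` and `d(g) = n`,
  for a unique pair `(f, g)` -/
  factorization : ∀ {z x : Λ} (h : z ⟶ x) (m n : Fin k → ℕ), degree h = m + n →
    ∃! p : (Σ y : Λ, (z ⟶ y) × (y ⟶ x)),
      p.2.1 ≫ p.2.2 = h ∧ degree p.2.2 = m ∧ degree p.2.1 = n
  /-- the category is countable (hence so is its set of objects) -/
  countable : Countable (Σ y x : Λ, (y ⟶ x))

namespace HigherRankGraph

/-- The type of all paths (morphisms) of `Λ`. -/
structure Path (Λ : Type u) [Category.{v} Λ] where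
  /-- the source -/
  s : Λ
  /-- the range -/
  r : Λ
  /-- the underlying morphism -/
  hom : s ⟶ r

variable {k : ℕ} {Λ : Type u} [Category.{v} Λ] (G : HigherRankGraph k Λ)

/-- The degree of a path. -/
def d (p : Path Λ) : Fin k → ℕ := G.degree p.hom

/-- The standard generator `e_i` of `ℕ^k`. -/
def e (i : Fin k) : Fin k → ℕ := Pi.single i 1

/-- `vΛ^n`, the set of paths of degree `n` with range `v`. -/
def pathsInto (x : Λ) (n : Fin k → ℕ) : Set (Path Λ) := {p | p.r = x ∧ G.d p = n}

/-- `Λ` is row-finite. -/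
def RowFinite : Prop := ∀ (x : Λ) (n : Fin k → ℕ), (G.pathsInto x n).Finite

/-- `Λ` is locally convex. -/
def LocallyConvex : Prop :=
  ∀ (x : Λ) (i j : Fin k), i ≠ j → ∀ p ∈ G.pathsInto x (e i), ∀ q ∈ G.pathsInto x (e j),
    (G.pathsInto p.s (e j)).Nonempty ∧ (G.pathsInto q.s (e i)).Nonempty

/-- `Λ^{≤ n}`. -/
def pathsLE (n : Fin k → ℕ) : Set (Path Λ) :=
  {p | G.d p ≤ n ∧ ∀ i, G.d p + e i ≤ n → G.pathsInto p.s (e i) = ∅}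

/-- Condition (MT3) for a set `M` of vertices. (A path in `vΛw` is a morphism `w ⟶ v`.) -/
def MT3 (M : Set Λ) : Prop :=
  ∀ v₁ ∈ M, ∀ v₂ ∈ M, ∃ y ∈ M, Nonempty (y ⟶ v₁) ∧ Nonempty (y ⟶ v₂)

/-- The Kumjian-Pask relations between elements `P x`, `S p`, `T p` of a ring `A`, where `P x` stands
for `P_x`, `S p` for `S_p` and `T p` for `S_{p^*}`. The functions `S` and `T` are given on all paths;
by the first two relations they extend the functions on paths of nonzero degree by the usual
convention `S_x = S_{x^*} = P_x` for vertices `x`. In `kp4`, the finite set `F` is `xΛ^{≤ n}`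
(which is finite when `Λ` is row-finite). -/
inductive KPRel {A : Type w} [NonUnitalSemiring A] (P : Λ → A) (S T : Path Λ → A) :
    A → A → Prop
  | path_vertex (x : Λ) : KPRel P S T (S ⟨x, x, 𝟙 x⟩) (P x)
  | ghost_vertex (x : Λ) : KPRel P S T (T ⟨x, x, 𝟙 x⟩) (P x)
  | kp1_idem (x : Λ) : KPRel P S T (P x * P x) (P x)
  | kp1_orth (x y : Λ) (h : x ≠ y) : KPRel P S T (P x * P y) 0
  | kp2_path {z y x : Λ} (f : y ⟶ x) (g : z ⟶ y) (hf : G.degree f ≠ 0) (hg : G.degree g ≠ 0) :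
      KPRel P S T (S ⟨y, x, f⟩ * S ⟨z, y, g⟩) (S ⟨z, x, g ≫ f⟩)
  | kp2_ghost {z y x : Λ} (f : y ⟶ x) (g : z ⟶ y) (hf : G.degree f ≠ 0) (hg : G.degree g ≠ 0) :
      KPRel P S T (T ⟨z, y, g⟩ * T ⟨y, x, f⟩) (T ⟨z, x, g ≫ f⟩)
  | kp2_range_path (p : Path Λ) (hp : G.d p ≠ 0) : KPRel P S T (P p.r * S p) (S p)
  | kp2_path_source (p : Path Λ) (hp : G.d p ≠ 0) : KPRel P S T (S p * P p.s) (S p)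
  | kp2_source_ghost (p : Path Λ) (hp : G.d p ≠ 0) : KPRel P S T (P p.s * T p) (T p)
  | kp2_ghost_range (p : Path Λ) (hp : G.d p ≠ 0) : KPRel P S T (T p * P p.r) (T p)
  | kp3_eq (n : Fin k → ℕ) (hn : n ≠ 0) (p : Path Λ) (hp : p ∈ G.pathsLE n) :
      KPRel P S T (T p * S p) (P p.s)
  | kp3_ne (n : Fin k → ℕ) (hn : n ≠ 0) (p q : Path Λ) (hp : p ∈ G.pathsLE n)
      (hq : q ∈ G.pathsLE n) (hpq : p ≠ q) : KPRel P S T (T p * S q) 0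
  | kp4 (x : Λ) (n : Fin k → ℕ) (hn : n ≠ 0) (F : Finset (Path Λ))
      (hF : ∀ p, p ∈ F ↔ p ∈ G.pathsLE n ∧ p.r = x) :
      KPRel P S T (P x) (∑ p ∈ F, S p * T p)

/-- `(P, S, T)` is a Kumjian-Pask `Λ`-family in the (possibly non-unital) ring `A`. -/
def IsKPFamily {A : Type w} [NonUnitalSemiring A] (P : Λ → A) (S T : Path Λ → A) : Prop :=
  ∀ a b, G.KPRel P S T a b → a = b

/-- The symbols `p_x`, `s_p` and `s_{p^*}`. -/
inductive Gen (Λ : Type u) [Category.{v} Λ]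
  | vertex (x : Λ)
  | path (p : Path Λ)
  | ghost (p : Path Λ)

variable (R : Type w) [CommRing R]

/-- The unital `R`-algebra presented by the generators `Gen Λ` and the Kumjian-Pask relations: the
universal Kumjian-Pask algebra with a unit adjoined. -/
abbrev UnitalKP : Type _ :=
  RingQuot (G.KPRel (A := FreeAlgebra R (Gen Λ)) (fun x => FreeAlgebra.ι R (.vertex x))
    (fun p => FreeAlgebra.ι R (.path p)) (fun p => FreeAlgebra.ι R (.ghost p)))

/-- The image of a generator. -/
noncomputable def gen (a : Gen Λ) : G.UnitalKP R :=
  RingQuot.mkAlgHom R _ (FreeAlgebra.ι R a)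

/-- The Kumjian-Pask algebra `KP_R(Λ)`, as the non-unital `R`-subalgebra generated by the `p_x`, `s_p`,
`s_{p^*}`. It is the universal (non-unital) `R`-algebra generated by a Kumjian-Pask `Λ`-family; see
`KP.isKPFamily`, `KP.adjoin_eq_top` and `KP.exists_lift`. -/
def KP : NonUnitalSubalgebra R (G.UnitalKP R) :=
  NonUnitalAlgebra.adjoin R (Set.range (G.gen R))

/-- The generators, as elements of `KP_R(Λ)`. -/
noncomputable def KP.of (a : Gen Λ) : G.KP R :=
  ⟨G.gen R a, NonUnitalAlgebra.subset_adjoin R ⟨a, rfl⟩⟩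

variable {G} in
/-- A ring homomorphism preserves the Kumjian-Pask relations. -/
theorem KPRel.map {A : Type w} {B : Type z} [NonUnitalSemiring A] [NonUnitalSemiring B]
    (φ : A →ₙ+* B) {P : Λ → A} {S T : Path Λ → A} {a b : A} (h : G.KPRel P S T a b) :
    G.KPRel (φ ∘ P) (φ ∘ S) (φ ∘ T) (φ a) (φ b) := by
  cases h <;> try simp only [map_mul, map_zero, map_sum]
  case path_vertex x => exact .path_vertex x
  case ghost_vertex x => exact .ghost_vertex x
  case kp1_idem x => exact .kp1_idem x
  case kp1_orth x y h => exact .kp1_orth x y h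
  case kp2_path f g hf hg => exact .kp2_path f g hf hg
  case kp2_ghost f g hf hg => exact .kp2_ghost f g hf hg
  case kp2_range_path p hp => exact .kp2_range_path p hp
  case kp2_path_source p hp => exact .kp2_path_source p hp
  case kp2_source_ghost p hp => exact .kp2_source_ghost p hp
  case kp2_ghost_range p hp => exact .kp2_ghost_range p hp
  case kp3_eq n hn p hp => exact .kp3_eq n hn p hp
  case kp3_ne n hn p q hp hq h => exact .kp3_ne n hn p q hp hq h
  case kp4 x n hn F hF => exact .kp4 x n hn F hF

/-- The generators of `KP_R(Λ)` form a Kumjian-Pask `Λ`-family. -/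
theorem KP.isKPFamily :
    G.IsKPFamily (A := G.KP R) (fun x => KP.of G R (.vertex x))
      (fun p => KP.of G R (.path p)) (fun p => KP.of G R (.ghost p)) := by
  intro a b h
  have h1 := h.map (NonUnitalSubalgebraClass.subtype (G.KP R) : G.KP R →ₙ+* G.UnitalKP R)
  have key : ∀ a b, G.KPRel (A := G.UnitalKP R) (fun x => G.gen R (.vertex x))
      (fun p => G.gen R (.path p)) (fun p => G.gen R (.ghost p)) a b → a = b := by
    intro a b h
    have hr := fun x y hxy => RingQuot.mkAlgHom_rel R
      (s := (G.KPRel (A := FreeAlgebra R (Gen Λ)) (fun x => FreeAlgebra.ι R (.vertex x))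
        (fun p => FreeAlgebra.ι R (.path p)) (fun p => FreeAlgebra.ι R (.ghost p))))
      (x := x) (y := y) hxy
    cases h
    case path_vertex x => exact hr _ _ (.path_vertex x)
    case ghost_vertex x => exact hr _ _ (.ghost_vertex x)
    case kp1_idem x => simpa [gen] using hr _ _ (.kp1_idem x)
    case kp1_orth x y h => simpa [gen] using hr _ _ (.kp1_orth x y h)
    case kp2_path f g hf hg => simpa [gen] using hr _ _ (.kp2_path f g hf hg)
    case kp2_ghost f g hf hg => simpa [gen] using hr _ _ (.kp2_ghost f g hf hg)
    case kp2_range_path p hp => simpa [gen] using hr _ _ (.kp2_range_path p hp)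
    case kp2_path_source p hp => simpa [gen] using hr _ _ (.kp2_path_source p hp)
    case kp2_source_ghost p hp => simpa [gen] using hr _ _ (.kp2_source_ghost p hp)
    case kp2_ghost_range p hp => simpa [gen] using hr _ _ (.kp2_ghost_range p hp)
    case kp3_eq n hn p hp => simpa [gen] using hr _ _ (.kp3_eq n hn p hp)
    case kp3_ne n hn p q hp hq h => simpa [gen] using hr _ _ (.kp3_ne n hn p q hp hq h)
    case kp4 x n hn F hF => simpa [gen] using hr _ _ (.kp4 x n hn F hF)
  exact Subtype.ext (key _ _ h1)

/-- `KP_R(Λ)` is generated by its Kumjian-Pask `Λ`-family. -/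
theorem KP.adjoin_eq_top : NonUnitalAlgebra.adjoin R (Set.range (KP.of G R)) = ⊤ := by
  have h : Set.range (KP.of G R) = ((↑) : G.KP R → G.UnitalKP R) ⁻¹' Set.range (G.gen R) := by
    ext a
    constructor
    · rintro ⟨g, rfl⟩
      exact ⟨g, rfl⟩
    · rintro ⟨g, hg⟩
      exact ⟨g, Subtype.ext hg⟩
  rw [h]
  refine top_unique fun a _ => ?_
  obtain ⟨a, ha⟩ := a
  induction ha using NonUnitalAlgebra.adjoin_induction with
  | mem x hx => exact NonUnitalAlgebra.subset_adjoin R hx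
  | add x y hx hy h1 h2 => exact add_mem (h1 trivial) (h2 trivial)
  | zero => exact zero_mem _
  | mul x y hx hy h1 h2 => exact mul_mem (h1 trivial) (h2 trivial)
  | smul r x hx h1 => exact SMulMemClass.smul_mem r (h1 trivial)

/-- `KP_R(Λ)` is universal: every Kumjian-Pask `Λ`-family in an `R`-algebra is the image of the
generating one under an `R`-algebra homomorphism. -/
theorem KP.exists_lift {A : Type z} [NonUnitalRing A] [Module R A] [IsScalarTower R A A]
    [SMulCommClass R A A] (P : Λ → A) (S T : Path Λ → A) (h : G.IsKPFamily P S T) :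
    ∃ φ : G.KP R →ₙₐ[R] A, (∀ x, φ (KP.of G R (.vertex x)) = P x) ∧
      (∀ p, φ (KP.of G R (.path p)) = S p) ∧ (∀ p, φ (KP.of G R (.ghost p)) = T p) := by
  let c : Gen Λ → A := fun a => match a with
    | .vertex x => P x
    | .path p => S p
    | .ghost p => T p
  let ψ₀ : FreeAlgebra R (Gen Λ) →ₐ[R] Unitization R A :=
    FreeAlgebra.lift R (fun a => (c a : Unitization R A))
  have hι : ∀ a, ψ₀ (FreeAlgebra.ι R a) = (c a : Unitization R A) := fun a => by simp [ψ₀]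
  have hfam : G.IsKPFamily (fun x => (P x : Unitization R A)) (fun p => (S p : Unitization R A))
      (fun p => (T p : Unitization R A)) := by
    intro a b hab
    let f : A →ₙ+* Unitization R A := (Unitization.inrNonUnitalAlgHom R A : A →ₙ+* Unitization R A)
    cases hab
    case path_vertex x => exact congrArg f (h _ _ (.path_vertex x))
    case ghost_vertex x => exact congrArg f (h _ _ (.ghost_vertex x))
    case kp1_idem x => exact (map_mul f _ _).symm.trans (congrArg f (h _ _ (.kp1_idem x)))
    case kp1_orth x y hh => exact (map_mul f _ _).symm.trans (congrArg f (h _ _ (.kp1_orth x y hh)))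
    case kp2_path u g hf hg =>
      exact (map_mul f _ _).symm.trans (congrArg f (h _ _ (.kp2_path u g hf hg)))
    case kp2_ghost u g hf hg =>
      exact (map_mul f _ _).symm.trans (congrArg f (h _ _ (.kp2_ghost u g hf hg)))
    case kp2_range_path p hp =>
      exact (map_mul f _ _).symm.trans (congrArg f (h _ _ (.kp2_range_path p hp)))
    case kp2_path_source p hp =>
      exact (map_mul f _ _).symm.trans (congrArg f (h _ _ (.kp2_path_source p hp)))
    case kp2_source_ghost p hp =>
      exact (map_mul f _ _).symm.trans (congrArg f (h _ _ (.kp2_source_ghost p hp)))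
    case kp2_ghost_range p hp =>
      exact (map_mul f _ _).symm.trans (congrArg f (h _ _ (.kp2_ghost_range p hp)))
    case kp3_eq n hn p hp =>
      exact (map_mul f _ _).symm.trans (congrArg f (h _ _ (.kp3_eq n hn p hp)))
    case kp3_ne n hn p q hp hq hh =>
      exact (map_mul f _ _).symm.trans (congrArg f (h _ _ (.kp3_ne n hn p q hp hq hh)))
    case kp4 x n hn F hF =>
      refine (congrArg f (h _ _ (.kp4 x n hn F hF))).trans ((map_sum f _ _).trans ?_)
      exact Finset.sum_congr rfl fun p _ => map_mul f _ _
  let ψ : G.UnitalKP R →ₐ[R] Unitization R A := RingQuot.liftAlgHom R ⟨ψ₀, fun a b hab => by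
    have h1 := hab.map (ψ₀ : FreeAlgebra R (Gen Λ) →ₙ+* Unitization R A)
    have e1 : (ψ₀ : FreeAlgebra R (Gen Λ) →ₙ+* Unitization R A) ∘
        (fun x => FreeAlgebra.ι R (.vertex x)) = fun x => (P x : Unitization R A) :=
      funext fun x => hι (.vertex x)
    have e2 : (ψ₀ : FreeAlgebra R (Gen Λ) →ₙ+* Unitization R A) ∘
        (fun x => FreeAlgebra.ι R (.path x)) = fun x => (S x : Unitization R A) :=
      funext fun x => hι (.path x)
    have e3 : (ψ₀ : FreeAlgebra R (Gen Λ) →ₙ+* Unitization R A) ∘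
        (fun x => FreeAlgebra.ι R (.ghost x)) = fun x => (T x : Unitization R A) :=
      funext fun x => hι (.ghost x)
    rw [e1, e2, e3] at h1
    exact hfam _ _ h1⟩
  have hψ : ∀ a, ψ (G.gen R a) = (c a : Unitization R A) := fun a => by
    simp [ψ, gen, hι]
  have hle : ∀ a ∈ G.KP R, ∃ b : A, ψ a = (b : Unitization R A) := by
    intro a ha
    induction ha using NonUnitalAlgebra.adjoin_induction with
    | mem x hx => obtain ⟨g, rfl⟩ := hx; exact ⟨_, hψ g⟩
    | add x y _ _ hx hy =>
      obtain ⟨b, hb⟩ := hx; obtain ⟨b', hb'⟩ := hy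
      exact ⟨b + b', by simp [hb, hb']⟩
    | zero => exact ⟨0, by simp⟩
    | mul x y _ _ hx hy =>
      obtain ⟨b, hb⟩ := hx; obtain ⟨b', hb'⟩ := hy
      exact ⟨b * b', by simp [hb, hb']⟩
    | smul r x _ hx => obtain ⟨b, hb⟩ := hx; exact ⟨r • b, by simp [hb]⟩
  let φ : G.KP R →ₙₐ[R] A :=
    { toFun := fun a => (ψ a).snd
      map_smul' := fun r a => by simp
      map_zero' := by simp
      map_add' := fun a b => by simp
      map_mul' := fun a b => by
        obtain ⟨x, hx⟩ := hle a a.2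
        obtain ⟨y, hy⟩ := hle b b.2
        simp [hx, hy] }
  have hφ : ∀ a, φ (KP.of G R a) = c a := fun a => by
    change (ψ (G.gen R a)).snd = c a
    rw [hψ]; simp
  exact ⟨φ, fun x => hφ _, fun p => hφ _, fun p => hφ _⟩

end HigherRankGraph

/-- A ring `A`, not necessarily unital, is prime if its zero ideal is prime: it is proper, and if
`I * J` is contained in it for two-sided ideals `I` and `J`, then so is one of `I`, `J`. -/
def IsPrimeRing (A : Type w) [NonUnitalRing A] : Prop :=
  Nontrivial A ∧
    ∀ I J : TwoSidedIdeal A, (∀ a ∈ I, ∀ b ∈ J, a * b = 0) → I = ⊥ ∨ J = ⊥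

/-! The algebra is spanned by the products `s_p s_{q^*}` and graded over `ℤ^k` by `d(p) - d(q)`.
Suppose `R` is a domain, (MT3) holds, and nonzero `a`, `b` satisfy `a KP b = 0`. Since `ℤ^k` has
unique sums, `a` and `b` may be replaced by nonzero homogeneous components (`exists_homogeneous`). A
nonzero homogeneous element can be cut down to a nonzero scalar multiple of a vertex by multiplying
with a ghost path on the left and a path on the right (`exists_compression`). (MT3) joins the two
vertices so obtained through a common vertex `z`, and the hypothesis then forces a nonzero multiple
of `p_z` to vanish. This is impossible because vertices are torsion-free in the strong sense of
`eq_zero_of_smul_vertex_eq_zero`: in the representation on functions on boundary paths, `p_z` acts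
as the indicator of a nonempty set. No aperiodicity or uniqueness theorem is involved.

Conversely, `rs = 0` makes the ideals `r KP` and `s KP` multiply to zero. If `v₁`, `v₂` have no
common `w`, the spanning set shows `p_{v₁} KP p_{v₂} = 0`. Nonvanishing of multiples of vertices
turns both into failures of primeness. -/

namespace HigherRankGraph

/-! ### Factorization of paths and the sets `Λ^{≤ n}`. -/

variable {k : ℕ} {Λ : Type u} [Category.{v} Λ] (G : HigherRankGraph k Λ)

/-- If two factorizations of a path have first factors of the same degree, they agree. -/
theorem factorization_unique {z y y' x : Λ} {α : z ⟶ y} {μ : y ⟶ x} {α' : z ⟶ y'} {μ' : y' ⟶ x}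
    (h : α ≫ μ = α' ≫ μ') (hd : G.degree μ = G.degree μ') :
    (⟨y, (α, μ)⟩ : Σ y : Λ, (z ⟶ y) × (y ⟶ x)) = ⟨y', (α', μ')⟩ := by
  have h1 := G.degree_comp α μ
  have h2 := G.degree_comp α' μ'
  have h3 : G.degree α' = G.degree α := by
    rw [← h, h1, hd] at h2
    exact (add_left_cancel h2).symm
  exact (G.factorization (α ≫ μ) _ _ h1).unique ⟨rfl, rfl, rfl⟩ ⟨h.symm, hd.symm, h3⟩

/-- Composing `f` with the identity on either side gives two factorizations whose range-side factors
both have degree zero, so they coincide. -/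
theorem eq_id_of_d_eq_zero (p : Path Λ) (h : G.d p = 0) : ∃ x, p = ⟨x, x, 𝟙 x⟩ := by
  obtain ⟨y, x, f⟩ := p
  have h1 := G.factorization_unique (α := f) (μ := 𝟙 x) (α' := 𝟙 y) (μ' := f) (by simp)
    (by rw [G.degree_id]; exact h.symm)
  obtain rfl : x = y := congrArg Sigma.fst h1
  simp only [Sigma.mk.injEq, heq_eq_eq, Prod.mk.injEq, true_and] at h1
  exact ⟨x, by rw [h1.1]⟩

theorem comp_right_cancel (G : HigherRankGraph k Λ) {z y x : Λ} {α α' : z ⟶ y} {μ : y ⟶ x} (h : α ≫ μ = α' ≫ μ) :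
    α = α' := by
  have h1 := factorization_unique G h rfl
  simp only [Sigma.mk.injEq, heq_eq_eq, Prod.mk.injEq, true_and, and_true] at h1
  exact h1

theorem exists_factor {z x : Λ} (h : z ⟶ x) {m : Fin k → ℕ} (hm : m ≤ G.degree h) :
    ∃ (y : Λ) (ν : z ⟶ y) (μ : y ⟶ x), ν ≫ μ = h ∧ G.degree μ = m := by
  obtain ⟨⟨y, ν, μ⟩, ⟨h1, h2, -⟩, -⟩ := G.factorization h m (G.degree h - m)
    (add_tsub_cancel_of_le hm).symm
  exact ⟨y, ν, μ, h1, h2⟩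

theorem e_le_iff {i : Fin k} {n : Fin k → ℕ} : e i ≤ n ↔ n i ≠ 0 := by
  constructor
  · intro h
    have := h i
    simp only [e, Pi.single_eq_same] at this
    omega
  · intro h j
    by_cases hj : j = i
    · subst hj; simp only [e, Pi.single_eq_same]; omega
    · simp [e, Pi.single_eq_of_ne hj]

theorem add_e_le_iff {i : Fin k} {m n : Fin k → ℕ} (h : m ≤ n) : m + e i ≤ n ↔ m i < n i := by
  constructor
  · intro h
    have := h i
    simp only [e, Pi.add_apply, Pi.single_eq_same] at this
    omega
  · intro h1 j
    by_cases hj : j = i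
    · subst hj; simp only [e, Pi.add_apply, Pi.single_eq_same]; omega
    · simpa [e, Pi.single_eq_of_ne hj] using h j

theorem pathsInto_nonempty_of_degree_ne_zero {z y : Λ} (f : z ⟶ y) {i : Fin k}
    (h : G.degree f i ≠ 0) : (G.pathsInto y (e i)).Nonempty := by
  obtain ⟨w, ν, μ, -, h2⟩ := G.exists_factor f (e_le_iff.2 h)
  exact ⟨⟨w, y, μ⟩, rfl, h2⟩

theorem pathsInto_nonempty_of_hom {z y : Λ} (f : z ⟶ y) {i : Fin k}
    (h : (G.pathsInto z (e i)).Nonempty) : (G.pathsInto y (e i)).Nonempty := by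
  obtain ⟨⟨w, z', g⟩, rfl, hg⟩ := h
  refine G.pathsInto_nonempty_of_degree_ne_zero (g ≫ f) (i := i) ?_
  have h1 : G.degree g = e i := hg
  rw [G.degree_comp, h1]
  simp [e]

theorem mem_pathsLE_iff {y x : Λ} {f : y ⟶ x} {n : Fin k → ℕ} :
    (⟨y, x, f⟩ : Path Λ) ∈ G.pathsLE n ↔ G.degree f ≤ n ∧
      ∀ i, G.degree f i < n i → ¬ (G.pathsInto y (e i)).Nonempty := by
  simp only [pathsLE, d, Set.mem_ofPred_eq, Set.not_nonempty_iff_eq_empty]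
  exact and_congr_right fun h => forall_congr' fun i => by rw [add_e_le_iff h]

theorem mem_pathsLE_d (p : Path Λ) : p ∈ G.pathsLE (G.d p) :=
  G.mem_pathsLE_iff.2 ⟨le_rfl, fun _ h => absurd h (lt_irrefl _)⟩

variable {G}

/-- In a locally convex `k`-graph, edges of degree `e i` can be pulled along paths whose degree
vanishes at `i`. -/
theorem LocallyConvex.pathsInto_nonempty (hG : G.LocallyConvex) {z y : Λ} (f : z ⟶ y) {i : Fin k}
    (hf : G.degree f i = 0) (hy : (G.pathsInto y (e i)).Nonempty) :
    (G.pathsInto z (e i)).Nonempty := by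
  -- Induction on the total degree: remove from the range end of `f` one edge in a direction `j ≠
  -- i`, and push the `e i`-edge past it by local convexity.
  induction hN : ∑ j, G.degree f j using Nat.strong_induction_on generalizing y with
  | _ N ih =>
    by_cases h0 : G.degree f = 0
    · obtain ⟨x, hx⟩ := G.eq_id_of_d_eq_zero ⟨z, y, f⟩ h0
      obtain rfl : z = x := congrArg Path.s hx
      obtain rfl : y = z := congrArg Path.r hx
      exact hy
    · obtain ⟨j, hj⟩ := Function.ne_iff.1 h0
      have hij : i ≠ j := by rintro rfl; exact hj hf
      obtain ⟨w, ν, μ, rfl, h2⟩ := G.exists_factor f (e_le_iff.2 hj)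
      obtain ⟨p, hp⟩ := hy
      have hw := (hG y i j hij p hp ⟨w, y, μ⟩ ⟨rfl, h2⟩).2
      rw [G.degree_comp] at hf hN
      simp only [Pi.add_apply] at hf hN
      refine ih _ ?_ ν (by omega) hw rfl
      rw [← hN]
      refine Finset.sum_lt_sum (fun _ _ => by omega) ⟨j, Finset.mem_univ _, ?_⟩
      simp [h2, e]

/-- If the total degree falls short of `m + n` at `i`, then `g` or `f` falls short of its own bound.
In the second case an `e i`-edge at the source of `g` would produce one at the source of `f`. -/
theorem comp_mem_pathsLE {z y x : Λ} {g : z ⟶ y} {f : y ⟶ x} {m n : Fin k → ℕ}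
    (hf : (⟨y, x, f⟩ : Path Λ) ∈ G.pathsLE m) (hg : (⟨z, y, g⟩ : Path Λ) ∈ G.pathsLE n) :
    (⟨z, x, g ≫ f⟩ : Path Λ) ∈ G.pathsLE (m + n) := by
  rw [mem_pathsLE_iff] at *
  rw [G.degree_comp]
  refine ⟨add_le_add hf.1 hg.1, fun i hi h => ?_⟩
  have h1 : G.degree f i ≤ m i := hf.1 i
  have h2 : G.degree g i ≤ n i := hg.1 i
  simp only [Pi.add_apply] at hi
  by_cases h3 : G.degree g i < n i
  · exact hg.2 i h3 h
  · exact hf.2 i (by omega) (G.pathsInto_nonempty_of_hom g h)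

/-- In a locally convex `k`-graph, paths in `Λ^{≤ m}` have initial segments in `Λ^{≤ n}`. -/
theorem LocallyConvex.exists_prefix (hG : G.LocallyConvex) {z x : Λ} {h : z ⟶ x} {m n : Fin k → ℕ}
    (hh : (⟨z, x, h⟩ : Path Λ) ∈ G.pathsLE m) (hnm : n ≤ m) :
    ∃ (y : Λ) (ν : z ⟶ y) (μ : y ⟶ x), ν ≫ μ = h ∧ (⟨y, x, μ⟩ : Path Λ) ∈ G.pathsLE n := by
  -- Where the segment of degree `n ⊓ d(h)` falls short of `n`, the remainder `ν` has degree zero,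
  -- so an edge at `y` would be pulled back to `z`, against the maximality of `h`.
  obtain ⟨y, ν, μ, rfl, h2⟩ := G.exists_factor h (m := n ⊓ G.degree h) inf_le_right
  rw [mem_pathsLE_iff] at hh
  refine ⟨y, ν, μ, rfl, G.mem_pathsLE_iff.2 ⟨h2.le.trans inf_le_left, fun i hi hne => ?_⟩⟩
  have h3 : G.degree μ i = min (n i) (G.degree (ν ≫ μ) i) := congrFun h2 i
  have h4 : n i ≤ m i := hnm i
  have h5 : G.degree (ν ≫ μ) i = G.degree μ i + G.degree ν i := congrFun (G.degree_comp ν μ) i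
  exact hh.2 i (by omega) (hG.pathsInto_nonempty ν (by omega) hne)

theorem mem_pathsLE_of_comp {z y x : Λ} {g : z ⟶ y} {f : y ⟶ x} {m n : Fin k → ℕ}
    (hf : (⟨y, x, f⟩ : Path Λ) ∈ G.pathsLE m)
    (h : (⟨z, x, g ≫ f⟩ : Path Λ) ∈ G.pathsLE (m + n)) : (⟨z, y, g⟩ : Path Λ) ∈ G.pathsLE n := by
  rw [mem_pathsLE_iff] at *
  rw [G.degree_comp] at h
  refine ⟨fun i => ?_, fun i hi => h.2 i ?_⟩
  · have h1 : G.degree f i + G.degree g i ≤ m i + n i := h.1 i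
    have h2 : G.degree f i ≤ m i := hf.1 i
    change G.degree g i ≤ n i
    -- Where `f` falls short of `m`, its source receives no `e i`-edge, so `g` cannot move in
    -- direction `i`.
    by_cases h3 : G.degree f i < m i
    · have := mt (G.pathsInto_nonempty_of_degree_ne_zero g) (hf.2 i h3)
      omega
    · omega
  · have h2 : G.degree f i ≤ m i := hf.1 i
    simp only [Pi.add_apply]
    omega

/-- Distinct elements of `Λ^{≤ n}` have no common extension. -/
theorem eq_of_mem_pathsLE {z y y' x : Λ} {μ : y ⟶ x} {μ' : y' ⟶ x} {n : Fin k → ℕ}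
    (hμ : (⟨y, x, μ⟩ : Path Λ) ∈ G.pathsLE n) (hμ' : (⟨y', x, μ'⟩ : Path Λ) ∈ G.pathsLE n)
    {α : z ⟶ y} {α' : z ⟶ y'} (h : α ≫ μ = α' ≫ μ') :
    (⟨y, x, μ⟩ : Path Λ) = ⟨y', x, μ'⟩ := by
  rw [mem_pathsLE_iff] at *
  have h1 := G.degree_comp α μ
  have h2 := G.degree_comp α' μ'
  rw [← h, h1] at h2
  -- The shorter of the two in direction `i` would have to be continued in that direction, but it is
  -- below `n i` there and hence cannot be.
  have key : G.degree μ = G.degree μ' := by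
    ext i
    have h3 := congrFun h2 i
    have h4 : G.degree μ i ≤ n i := hμ.1 i
    have h5 : G.degree μ' i ≤ n i := hμ'.1 i
    simp only [Pi.add_apply] at h3
    rcases lt_trichotomy (G.degree μ i) (G.degree μ' i) with hlt | heq | hlt
    · have := mt (G.pathsInto_nonempty_of_degree_ne_zero α) (hμ.2 i (by omega))
      omega
    · exact heq
    · have := mt (G.pathsInto_nonempty_of_degree_ne_zero α') (hμ'.2 i (by omega))
      omega
  have h6 := G.factorization_unique h key
  exact congrArg (fun q : Σ y : Λ, (z ⟶ y) × (y ⟶ x) => (⟨q.1, x, q.2.2⟩ : Path Λ)) h6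

variable (G)

/-- A path of degree at most `n` outside `Λ^{≤ n}` can be lengthened by an edge while staying below
`n`. This must stop, since total degree is bounded by `∑ i, n i`. -/
theorem exists_mem_pathsLE (x : Λ) (n : Fin k → ℕ) :
    ∃ (y : Λ) (f : y ⟶ x), (⟨y, x, f⟩ : Path Λ) ∈ G.pathsLE n := by
  by_contra! hcon
  have key : ∀ N : ℕ, ∃ (y : Λ) (f : y ⟶ x), G.degree f ≤ n ∧ N ≤ ∑ i, G.degree f i := by
    intro N
    induction N with
    | zero => exact ⟨x, 𝟙 x, by rw [G.degree_id]; exact fun _ => Nat.zero_le _, Nat.zero_le _⟩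
    | succ N ih =>
      obtain ⟨y, f, h1, h2⟩ := ih
      have h3 := mt G.mem_pathsLE_iff.2 (hcon y f)
      push Not at h3
      obtain ⟨i, hi, ⟨w, y', g⟩, rfl, hg⟩ := h3 h1
      have hg' : G.degree g = e i := hg
      refine ⟨w, g ≫ f, ?_, ?_⟩
      · rw [G.degree_comp, hg']
        exact (add_e_le_iff h1).2 hi
      · rw [G.degree_comp, hg']
        simp only [Pi.add_apply, Finset.sum_add_distrib]
        have : ∑ j, (e i : Fin k → ℕ) j = 1 := by simp [e]
        omega
  obtain ⟨y, f, h1, h2⟩ := key (∑ i, n i + 1)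
  have := Finset.sum_le_sum fun i (_ : i ∈ Finset.univ) => h1 i
  omega

variable {G}

theorem RowFinite.exists_finset (hG : G.RowFinite) (x : Λ) (n : Fin k → ℕ) :
    ∃ F : Finset (Path Λ), ∀ p, p ∈ F ↔ p ∈ G.pathsLE n ∧ p.r = x := by
  have h : {p | p ∈ G.pathsLE n ∧ p.r = x}.Finite :=
    ((Set.finite_Iic n).biUnion fun m _ => hG x m).subset fun p hp =>
      Set.mem_biUnion (x := G.d p) hp.1.1 ⟨hp.2, rfl⟩
  exact ⟨h.toFinset, fun p => by simp⟩

end HigherRankGraph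

/-! ### Boundary paths as directed families of initial segments. -/

namespace HigherRankGraph

variable {k : ℕ} {Λ : Type u} [Category.{v} Λ] (G : HigherRankGraph k Λ)

/-- A boundary path with range `x`, given by the collection of its finite initial segments. -/
@[ext]
structure Boundary (x : Λ) where
  /-- being an initial segment -/
  mem : ∀ y : Λ, (y ⟶ x) → Prop
  of_comp : ∀ {z y : Λ} (α : z ⟶ y) (μ : y ⟶ x), mem z (α ≫ μ) → mem y μ
  directed : ∀ {y y' : Λ} (μ : y ⟶ x) (μ' : y' ⟶ x), mem y μ → mem y' μ' →
    ∃ (z : Λ) (α : z ⟶ y) (α' : z ⟶ y'), α ≫ μ = α' ≫ μ' ∧ mem z (α ≫ μ)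
  exists_mem : ∀ n : Fin k → ℕ, ∃ (y : Λ) (μ : y ⟶ x), (⟨y, x, μ⟩ : Path Λ) ∈ G.pathsLE n ∧ mem y μ

variable {G}

namespace Boundary

theorem mem_id {x : Λ} (b : G.Boundary x) : b.mem x (𝟙 x) := by
  obtain ⟨y, μ, -, h⟩ := b.exists_mem 0
  exact b.of_comp μ (𝟙 x) (by simpa using h)

/-- Prepending a path to a boundary path. -/
def cons (hG : G.LocallyConvex) {y x : Λ} (f : y ⟶ x) (b : G.Boundary y) : G.Boundary x where
  mem w μ := ∃ (z : Λ) (ν : z ⟶ y) (α : z ⟶ w), b.mem z ν ∧ α ≫ μ = ν ≫ f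
  of_comp := by
    rintro w w' β μ ⟨z, ν, α, h1, h2⟩
    exact ⟨z, ν, α ≫ β, h1, by simpa using h2⟩
  directed := by
    rintro w w' μ μ' ⟨z, ν, α, h1, h2⟩ ⟨z', ν', α', h1', h2'⟩
    obtain ⟨t, β, β', h3, h4⟩ := b.directed ν ν' h1 h1'
    refine ⟨t, β ≫ α, β' ≫ α', ?_, t, β ≫ ν, 𝟙 t, h4, ?_⟩
    · rw [Category.assoc, Category.assoc, h2, h2', ← Category.assoc, h3, Category.assoc]
    · simp [h2]
  exists_mem n := by
    obtain ⟨z, ν, h1, h2⟩ := b.exists_mem n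
    -- The extended path lies in `Λ^{≤ d(f) + n}`; local convexity is what supplies its initial
    -- segment in `Λ^{≤ n}`.
    obtain ⟨t, α, μ, h3, h4⟩ := hG.exists_prefix
      (comp_mem_pathsLE (G.mem_pathsLE_d ⟨y, x, f⟩) h1) (le_add_of_nonneg_left zero_le)
    exact ⟨t, μ, h4, z, ν, α, h2, h3⟩

theorem mem_cons_comp (hG : G.LocallyConvex) {z y x : Λ} (f : y ⟶ x) (b : G.Boundary y)
    (ν : z ⟶ y) : (b.cons hG f).mem z (ν ≫ f) ↔ b.mem z ν := by
  constructor
  · rintro ⟨t, β, α, h1, h2⟩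
    rw [← Category.assoc] at h2
    have h3 := comp_right_cancel G h2
    exact b.of_comp α ν (h3 ▸ h1)
  · intro h
    exact ⟨z, ν, 𝟙 z, h, by simp⟩

theorem cons_injective (hG : G.LocallyConvex) {y x : Λ} (f : y ⟶ x) :
    Function.Injective (cons (G := G) hG f) := by
  intro b b' h
  ext z ν
  rw [← mem_cons_comp hG f b, h, mem_cons_comp]

theorem mem_cons_self (hG : G.LocallyConvex) {y x : Λ} (f : y ⟶ x) (b : G.Boundary y) :
    (b.cons hG f).mem y f :=
  ⟨y, 𝟙 y, 𝟙 y, b.mem_id, rfl⟩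

theorem cons_id (hG : G.LocallyConvex) {x : Λ} (b : G.Boundary x) : b.cons hG (𝟙 x) = b := by
  ext z ν
  simpa using mem_cons_comp hG (𝟙 x) b ν

theorem cons_comp (hG : G.LocallyConvex) {z y x : Λ} (g : z ⟶ y) (f : y ⟶ x) (b : G.Boundary z) :
    b.cons hG (g ≫ f) = (b.cons hG g).cons hG f := by
  ext w μ
  constructor
  · rintro ⟨t, ν, α, h1, h2⟩
    exact ⟨t, ν ≫ g, α, (mem_cons_comp hG g b ν).2 h1, by simpa using h2⟩
  · rintro ⟨t, ν, α, ⟨t', ν', α', h1, h2⟩, h3⟩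
    refine ⟨t', ν', α' ≫ α, h1, ?_⟩
    rw [Category.assoc, h3, ← Category.assoc, h2, Category.assoc]

/-- Two initial segments of a boundary path lying in `Λ^{≤ n}` agree. -/
theorem path_unique {x : Λ} (b : G.Boundary x) {y y' : Λ} {μ : y ⟶ x} {μ' : y' ⟶ x}
    {n : Fin k → ℕ} (hμ : (⟨y, x, μ⟩ : Path Λ) ∈ G.pathsLE n)
    (hμ' : (⟨y', x, μ'⟩ : Path Λ) ∈ G.pathsLE n) (h : b.mem y μ) (h' : b.mem y' μ') :
    (⟨y, x, μ⟩ : Path Λ) = ⟨y', x, μ'⟩ := by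
  obtain ⟨_, _, _, h1, -⟩ := b.directed μ μ' h h'
  exact eq_of_mem_pathsLE hμ hμ' h1

/-- An initial segment of a boundary path can be removed. -/
theorem exists_cons_eq (hG : G.LocallyConvex) {y x : Λ} (b : G.Boundary x) (f : y ⟶ x)
    (hf : b.mem y f) : ∃ c : G.Boundary y, c.cons hG f = b := by
  refine ⟨⟨fun z ν => b.mem z (ν ≫ f), ?_, ?_, ?_⟩, ?_⟩
  · intro z z' α μ h
    exact b.of_comp α (μ ≫ f) (by simpa using h)
  · intro z z' μ μ' h h'
    obtain ⟨t, α, α', h1, h2⟩ := b.directed _ _ h h'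
    rw [← Category.assoc, ← Category.assoc] at h1
    exact ⟨t, α, α', comp_right_cancel G h1, by simpa using h2⟩
  · intro n
    -- The prefix of `ρ` in `Λ^{≤ d(f)}` must be `f` itself by uniqueness, so what remains of `ρ`
    -- lies in `Λ^{≤ n}`.
    obtain ⟨z, ρ, h1, h2⟩ := b.exists_mem (G.degree f + n)
    obtain ⟨t, ν, μ, rfl, h3⟩ := hG.exists_prefix h1 (n := G.degree f) (le_add_of_nonneg_right zero_le)
    have h4 := b.path_unique h3 (G.mem_pathsLE_d ⟨y, x, f⟩) (b.of_comp ν μ h2) hf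
    cases h4
    exact ⟨z, ν, mem_pathsLE_of_comp h3 h1, h2⟩
  · ext w μ
    constructor
    · rintro ⟨z, ν, α, h1, h2⟩
      exact b.of_comp α μ (h2 ▸ h1)
    · intro h
      obtain ⟨t, α, α', h1, h2⟩ := b.directed _ _ h hf
      exact ⟨t, α', α, show b.mem t (α' ≫ f) from h1 ▸ h2, h1⟩

/-- Extend repeatedly by elements of `Λ^{≤ (1,…,1)}`. The `j`-th stage lies in `Λ^{≤ (j,…,j)}`, and
the initial segments of all stages form a boundary path. -/
theorem nonempty (hG : G.LocallyConvex) (x : Λ) : Nonempty (G.Boundary x) := by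
  choose t g hg using fun y => G.exists_mem_pathsLE y (1 : Fin k → ℕ)
  let step : (Σ y : Λ, (y ⟶ x)) → Σ y : Λ, (y ⟶ x) := fun q => ⟨t q.1, g q.1 ≫ q.2⟩
  let q : ℕ → Σ y : Λ, (y ⟶ x) := fun j => step^[j] ⟨x, 𝟙 x⟩
  have hq : ∀ j, q (j + 1) = step (q j) := fun j => Function.iterate_succ_apply' _ _ _
  have hext : ∀ i j, ∃ α : (q (i + j)).1 ⟶ (q i).1, α ≫ (q i).2 = (q (i + j)).2 := by
    intro i j
    induction j with
    | zero => exact ⟨𝟙 _, Category.id_comp _⟩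
    | succ j ih =>
      obtain ⟨α, hα⟩ := ih
      rw [← add_assoc, hq]
      exact ⟨g _ ≫ α, by simp [hα, step]⟩
  have hle : ∀ j, (⟨_, _, (q j).2⟩ : Path Λ) ∈ G.pathsLE (fun _ => j) := by
    intro j
    induction j with
    | zero =>
      have h := G.mem_pathsLE_d ⟨x, x, 𝟙 x⟩
      rw [show G.d ⟨x, x, 𝟙 x⟩ = 0 from G.degree_id x] at h
      exact h
    | succ j ih =>
      rw [hq]
      exact comp_mem_pathsLE (m := fun _ => j) (n := 1) ih (hg _)
  refine ⟨⟨fun y μ => ∃ (j : ℕ) (α : (q j).1 ⟶ y), α ≫ μ = (q j).2, ?_, ?_, ?_⟩⟩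
  · rintro z y β μ ⟨j, α, h⟩
    exact ⟨j, α ≫ β, by simpa using h⟩
  · rintro y y' μ μ' ⟨i, α, h⟩ ⟨j, α', h'⟩
    obtain ⟨β, hβ⟩ := hext i j
    obtain ⟨β', hβ'⟩ : ∃ α : (q (i + j)).1 ⟶ (q j).1, α ≫ (q j).2 = (q (i + j)).2 :=
      add_comm j i ▸ hext j i
    refine ⟨_, β ≫ α, β' ≫ α', ?_, i + j, 𝟙 _, ?_⟩
    · rw [Category.assoc, Category.assoc, h, h', hβ, hβ']
    · rw [Category.id_comp, Category.assoc, h, hβ]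
  · intro n
    -- Any stage dominating every coordinate of `n` works; `∑ i, n i` is a convenient choice.
    obtain ⟨y, ν, μ, h1, h2⟩ := hG.exists_prefix (hle (∑ i, n i)) (n := n)
      fun i => Finset.single_le_sum (f := n) (fun _ _ => Nat.zero_le _) (Finset.mem_univ i)
    exact ⟨y, μ, h2, _, ν, h1⟩

end Boundary

end HigherRankGraph

/-! ### Partial equivalences acting on functions. -/

namespace PEquiv

variable {α : Type u} {β : Type v}

open Classical in
/-- The partial equivalence given by a relation that is functional in both directions. -/
noncomputable def ofRel (r : α → β → Prop) (h₁ : ∀ a b b', r a b → r a b' → b = b')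
    (h₂ : ∀ a a' b, r a b → r a' b → a = a') : α ≃. β where
  toFun a := if h : ∃ b, r a b then some h.choose else none
  invFun b := if h : ∃ a, r a b then some h.choose else none
  inv a b := by
    have key1 : (b ∈ if h : ∃ b, r a b then some h.choose else none) ↔ r a b := by
      split_ifs with h
      · rw [Option.mem_some_iff]
        exact ⟨fun e => e ▸ h.choose_spec, fun e => h₁ _ _ _ h.choose_spec e⟩
      · exact ⟨fun e => by simp at e, fun e => absurd ⟨b, e⟩ h⟩
    have key2 : (a ∈ if h : ∃ a, r a b then some h.choose else none) ↔ r a b := by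
      split_ifs with h
      · rw [Option.mem_some_iff]
        exact ⟨fun e => e ▸ h.choose_spec, fun e => h₂ _ _ _ h.choose_spec e⟩
      · exact ⟨fun e => by simp at e, fun e => absurd ⟨a, e⟩ h⟩
    exact key2.trans key1.symm

theorem mem_ofRel {r : α → β → Prop} {h₁ : ∀ a b b', r a b → r a b' → b = b'}
    {h₂ : ∀ a a' b, r a b → r a' b → a = a'} {a : α} {b : β} : b ∈ ofRel r h₁ h₂ a ↔ r a b := by
  classical
  change (b ∈ if h : ∃ b, r a b then some h.choose else none) ↔ r a b
  split_ifs with h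
  · rw [Option.mem_some_iff]
    exact ⟨fun e => e ▸ h.choose_spec, fun e => h₁ _ _ _ h.choose_spec e⟩
  · exact ⟨fun e => by simp at e, fun e => absurd ⟨b, e⟩ h⟩

theorem ext_mem {f g : α ≃. β} (h : ∀ a b, b ∈ f a ↔ b ∈ g a) : f = g :=
  PEquiv.ext fun a => Option.ext fun b => h a b

variable (R : Type w) [CommRing R]

/-- Pulling functions back along a partial equivalence, with value `0` where it is undefined. -/
def pull (f : α ≃. α) : Module.End R (α → R) where
  toFun φ a := (f a).elim 0 φ
  map_add' φ ψ := by
    ext a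
    cases h : f a <;> simp [h]
  map_smul' r φ := by
    ext a
    cases h : f a <;> simp [h]

variable {R}

theorem pull_apply_of_mem {f : α ≃. α} {a b : α} (h : b ∈ f a) (φ : α → R) :
    pull R f φ a = φ b := by
  change (f a).elim 0 φ = φ b
  rw [Option.mem_def.1 h]
  rfl

theorem pull_apply_of_forall_notMem {f : α ≃. α} {a : α} (h : ∀ b, b ∉ f a) (φ : α → R) :
    pull R f φ a = 0 := by
  change (f a).elim 0 φ = 0
  rw [Option.eq_none_iff_forall_not_mem.2 h]
  rfl

/-- Pulling back reverses composition, which matches `trans` (first `f`, then `g`) with the product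
of endomorphisms. -/
theorem pull_mul (f g : α ≃. α) : pull R f * pull R g = pull R (f.trans g) := by
  ext φ a
  change (f a).elim 0 (fun b => (g b).elim 0 φ) = ((f a).bind g).elim 0 φ
  cases f a <;> rfl

theorem pull_bot : pull R (⊥ : α ≃. α) = 0 := by
  ext φ a
  exact pull_apply_of_forall_notMem (fun b => by simp) φ

end PEquiv

/-! ### The boundary path representation and nonvanishing of vertices. -/

namespace HigherRankGraph

variable {k : ℕ} {Λ : Type u} [Category.{v} Λ] {G : HigherRankGraph k Λ}

/-- The partial action of a path on the set of all boundary paths. -/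
noncomputable def act (hG : G.LocallyConvex) (p : Path Λ) :
    (Σ x, G.Boundary x) ≃. (Σ x, G.Boundary x) :=
  PEquiv.ofRel (fun a b => ∃ c : G.Boundary p.s, a = ⟨p.s, c⟩ ∧ b = ⟨p.r, c.cons hG p.hom⟩)
    (by
      rintro a b b' ⟨c, rfl, rfl⟩ ⟨c', h, rfl⟩
      simp only [Sigma.mk.injEq, heq_eq_eq, true_and] at h
      rw [h])
    (by
      rintro a a' b ⟨c, rfl, rfl⟩ ⟨c', rfl, h⟩
      simp only [Sigma.mk.injEq, heq_eq_eq, true_and] at h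
      rw [Boundary.cons_injective hG p.hom h])

theorem mem_act {hG : G.LocallyConvex} {p : Path Λ} {a b : Σ x, G.Boundary x} :
    b ∈ act hG p a ↔ ∃ c : G.Boundary p.s, a = ⟨p.s, c⟩ ∧ b = ⟨p.r, c.cons hG p.hom⟩ :=
  PEquiv.mem_ofRel

theorem mem_act_id {hG : G.LocallyConvex} {x : Λ} {a b : Σ x, G.Boundary x} :
    b ∈ act hG ⟨x, x, 𝟙 x⟩ a ↔ a = b ∧ a.1 = x := by
  rw [mem_act]
  constructor
  · rintro ⟨c, rfl, rfl⟩
    simp [Boundary.cons_id]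
  · rintro ⟨rfl, rfl⟩
    exact ⟨a.2, rfl, by simp [Boundary.cons_id]⟩

theorem mem_act_id_self {hG : G.LocallyConvex} {x : Λ} (b : G.Boundary x) :
    (⟨x, b⟩ : Σ x, G.Boundary x) ∈ act hG ⟨x, x, 𝟙 x⟩ ⟨x, b⟩ :=
  mem_act_id.2 ⟨rfl, rfl⟩

theorem act_trans (hG : G.LocallyConvex) {z y x : Λ} (g : z ⟶ y) (f : y ⟶ x) :
    (act hG ⟨z, y, g⟩).trans (act hG ⟨y, x, f⟩) = act hG ⟨z, x, g ≫ f⟩ := by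
  refine PEquiv.ext_mem fun a b => ?_
  rw [PEquiv.mem_trans, mem_act]
  constructor
  · rintro ⟨t, h1, h2⟩
    obtain ⟨c, rfl, rfl⟩ := mem_act.1 h1
    obtain ⟨c', h3, rfl⟩ := mem_act.1 h2
    simp only [Sigma.mk.injEq, heq_eq_eq, true_and] at h3
    exact ⟨c, rfl, by rw [← h3, Boundary.cons_comp]⟩
  · rintro ⟨c, rfl, rfl⟩
    exact ⟨_, mem_act.2 ⟨c, rfl, rfl⟩, mem_act.2 ⟨_, rfl, by rw [Boundary.cons_comp]⟩⟩

theorem act_id_symm (hG : G.LocallyConvex) (x : Λ) :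
    (act hG (⟨x, x, 𝟙 x⟩ : Path Λ)).symm = act hG ⟨x, x, 𝟙 x⟩ := by
  refine PEquiv.ext_mem fun a b => ?_
  rw [PEquiv.mem_iff_mem, mem_act_id, mem_act_id]
  constructor <;> (rintro ⟨rfl, h⟩; exact ⟨rfl, h⟩)

theorem act_trans_symm_self (hG : G.LocallyConvex) (p : Path Λ) :
    (act hG p).trans (act hG p).symm = act hG ⟨p.s, p.s, 𝟙 p.s⟩ := by
  refine PEquiv.ext_mem fun a b => ?_
  simp only [PEquiv.mem_trans, PEquiv.mem_iff_mem]
  rw [mem_act_id]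
  constructor
  · rintro ⟨t, h1, h2⟩
    refine ⟨PEquiv.inj _ h1 h2, ?_⟩
    obtain ⟨c, rfl, -⟩ := mem_act.1 h1
    rfl
  · obtain ⟨x, a⟩ := a
    rintro ⟨rfl, h⟩
    obtain rfl : x = p.s := h
    exact ⟨_, mem_act.2 ⟨_, rfl, rfl⟩, mem_act.2 ⟨_, rfl, rfl⟩⟩

/-- A boundary path in both images would have `p` and `q` as initial segments, and it has only one
in `Λ^{≤ n}`. -/
theorem act_trans_symm_ne (hG : G.LocallyConvex) {n : Fin k → ℕ} {p q : Path Λ}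
    (hp : p ∈ G.pathsLE n) (hq : q ∈ G.pathsLE n) (hpq : p ≠ q) :
    (act hG p).trans (act hG q).symm = ⊥ := by
  refine PEquiv.ext_mem fun a b => ?_
  refine ⟨fun hb => ?_, fun hb => by simp at hb⟩
  simp only [PEquiv.mem_trans, PEquiv.mem_iff_mem] at hb
  obtain ⟨t, h1, h2⟩ := hb
  obtain ⟨y, x, f⟩ := p
  obtain ⟨y', x', g⟩ := q
  obtain ⟨c, rfl, rfl⟩ := mem_act.1 h1
  obtain ⟨c', rfl, h3⟩ := mem_act.1 h2
  obtain rfl : x = x' := congrArg Sigma.fst h3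
  simp only [Sigma.mk.injEq, heq_eq_eq, true_and] at h3
  exact (hpq ((c.cons hG f).path_unique hp hq (Boundary.mem_cons_self hG f c)
    (h3 ▸ Boundary.mem_cons_self hG g c'))).elim

/-- The boundary path representation. -/
theorem isKPFamily_pull (hG : G.LocallyConvex) (R : Type w) [CommRing R] :
    G.IsKPFamily (fun x => PEquiv.pull R (act hG ⟨x, x, 𝟙 x⟩))
      (fun p => PEquiv.pull R (act hG p).symm) (fun p => PEquiv.pull R (act hG p)) := by
  intro a b h
  cases h
  case path_vertex x => rw [act_id_symm]
  case ghost_vertex x => rfl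
  case kp1_idem x => rw [PEquiv.pull_mul, act_trans, Category.comp_id]
  case kp1_orth x y h =>
    rw [PEquiv.pull_mul, ← PEquiv.pull_bot]
    congr 1
    refine PEquiv.ext_mem fun a b => ?_
    refine ⟨fun hb => ?_, fun hb => by simp at hb⟩
    simp only [PEquiv.mem_trans, mem_act_id] at hb
    obtain ⟨t, ⟨rfl, h1⟩, -, h2⟩ := hb
    exact (h (h1.symm.trans h2)).elim
  case kp2_path f g hf hg => rw [PEquiv.pull_mul, ← PEquiv.symm_trans_rev, act_trans]
  case kp2_ghost f g hf hg => rw [PEquiv.pull_mul, act_trans]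
  case kp2_range_path p hp =>
    rw [PEquiv.pull_mul, ← act_id_symm, ← PEquiv.symm_trans_rev, act_trans, Category.comp_id]
  case kp2_path_source p hp =>
    rw [PEquiv.pull_mul, ← act_id_symm, ← PEquiv.symm_trans_rev, act_trans, Category.id_comp]
  case kp2_source_ghost p hp => rw [PEquiv.pull_mul, act_trans, Category.id_comp]
  case kp2_ghost_range p hp => rw [PEquiv.pull_mul, act_trans, Category.comp_id]
  case kp3_eq n hn p hp => rw [PEquiv.pull_mul, act_trans_symm_self]
  case kp3_ne n hn p q hp hq h =>
    rw [PEquiv.pull_mul, act_trans_symm_ne hG hp hq h, PEquiv.pull_bot]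
  case kp4 x n hn F hF =>
    refine LinearMap.ext fun φ => funext fun t => ?_
    rw [LinearMap.sum_apply, Finset.sum_apply]
    simp only [PEquiv.pull_mul]
    by_cases ht : t.1 = x
    · obtain ⟨x, t⟩ := t
      obtain rfl : x = _ := ht
      rw [PEquiv.pull_apply_of_mem (mem_act_id_self _)]
      -- Exactly one element of `xΛ^{≤ n}` is an initial segment of `t`; only its summand survives
      -- at `t`.
      obtain ⟨y, f, h1, h2⟩ := t.exists_mem n
      obtain ⟨c, rfl⟩ := t.exists_cons_eq hG f h2
      rw [Finset.sum_eq_single ⟨y, x, f⟩]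
      · refine (PEquiv.pull_apply_of_mem ?_ φ).symm
        rw [PEquiv.mem_trans]
        exact ⟨⟨y, c⟩, (PEquiv.mem_iff_mem _).2 (mem_act.2 ⟨c, rfl, rfl⟩),
          mem_act.2 ⟨c, rfl, rfl⟩⟩
      · rintro ⟨y', x', g⟩ hg hne
        obtain ⟨hg, rfl⟩ := (hF _).1 hg
        refine PEquiv.pull_apply_of_forall_notMem (fun b hb => ?_) φ
        rw [PEquiv.mem_trans] at hb
        obtain ⟨s, hs, -⟩ := hb
        rw [PEquiv.mem_iff_mem] at hs
        obtain ⟨c', rfl, h3⟩ := mem_act.1 hs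
        simp only [Sigma.mk.injEq, heq_eq_eq, true_and] at h3
        exact hne ((c.cons hG f).path_unique hg h1 (h3 ▸ Boundary.mem_cons_self hG g c') h2)
      · exact fun h => absurd ((hF _).2 ⟨h1, rfl⟩) h
    · rw [PEquiv.pull_apply_of_forall_notMem fun b hb => ht (mem_act_id.1 hb).2]
      refine (Finset.sum_eq_zero fun p hp => ?_).symm
      refine PEquiv.pull_apply_of_forall_notMem (fun b hb => ?_) φ
      rw [PEquiv.mem_trans] at hb
      obtain ⟨s, hs, -⟩ := hb
      rw [PEquiv.mem_iff_mem] at hs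
      obtain ⟨c', rfl, rfl⟩ := mem_act.1 hs
      exact ht ((hF _).1 hp).2

/-- Nonzero multiples of the vertex idempotents of `KP_R(Λ)` do not vanish. -/
theorem KP.eq_zero_of_smul_vertex_eq_zero (hG : G.LocallyConvex) (R : Type w) [CommRing R] {r : R}
    {x : Λ} (h : r • KP.of G R (.vertex x) = 0) : r = 0 := by
  obtain ⟨φ, hφ, -, -⟩ := KP.exists_lift G R _ _ _ (isKPFamily_pull hG R)
  obtain ⟨b⟩ := Boundary.nonempty hG x
  have h1 := congrArg φ h
  rw [map_smul, hφ, map_zero] at h1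
  -- Applied to the constant function `1` and evaluated at a boundary path with range `x`, the
  -- operator returns `r`.
  have h2 := congrFun (LinearMap.congr_fun h1 fun _ => 1) (⟨x, b⟩ : Σ x, G.Boundary x)
  rw [LinearMap.smul_apply, Pi.smul_apply,
    PEquiv.pull_apply_of_mem (mem_act_id_self _)] at h2
  simpa using h2

end HigherRankGraph

/-! ### The relations for paths of arbitrary degree, and the spanning set. -/

namespace HigherRankGraph

variable {k : ℕ} {Λ : Type u} [Category.{v} Λ] {G : HigherRankGraph k Λ}

namespace IsKPFamily

variable {A : Type w} [NonUnitalSemiring A] {P : Λ → A} {S T : Path Λ → A}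

theorem P_mul_P (hK : G.IsKPFamily P S T) (x : Λ) : P x * P x = P x := hK _ _ (.kp1_idem x)

theorem P_mul_P_of_ne (hK : G.IsKPFamily P S T) {x y : Λ} (h : x ≠ y) : P x * P y = 0 :=
  hK _ _ (.kp1_orth x y h)

theorem S_id (hK : G.IsKPFamily P S T) (x : Λ) : S ⟨x, x, 𝟙 x⟩ = P x := hK _ _ (.path_vertex x)

theorem T_id (hK : G.IsKPFamily P S T) (x : Λ) : T ⟨x, x, 𝟙 x⟩ = P x := hK _ _ (.ghost_vertex x)

theorem P_mul_S (hK : G.IsKPFamily P S T) (p : Path Λ) : P p.r * S p = S p := by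
  by_cases h : G.d p = 0
  · obtain ⟨x, rfl⟩ := G.eq_id_of_d_eq_zero p h
    rw [hK.S_id, hK.P_mul_P]
  · exact hK _ _ (.kp2_range_path p h)

theorem S_mul_P (hK : G.IsKPFamily P S T) (p : Path Λ) : S p * P p.s = S p := by
  by_cases h : G.d p = 0
  · obtain ⟨x, rfl⟩ := G.eq_id_of_d_eq_zero p h
    rw [hK.S_id, hK.P_mul_P]
  · exact hK _ _ (.kp2_path_source p h)

theorem P_mul_T (hK : G.IsKPFamily P S T) (p : Path Λ) : P p.s * T p = T p := by
  by_cases h : G.d p = 0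
  · obtain ⟨x, rfl⟩ := G.eq_id_of_d_eq_zero p h
    rw [hK.T_id, hK.P_mul_P]
  · exact hK _ _ (.kp2_source_ghost p h)

theorem T_mul_P (hK : G.IsKPFamily P S T) (p : Path Λ) : T p * P p.r = T p := by
  by_cases h : G.d p = 0
  · obtain ⟨x, rfl⟩ := G.eq_id_of_d_eq_zero p h
    rw [hK.T_id, hK.P_mul_P]
  · exact hK _ _ (.kp2_ghost_range p h)

theorem S_mul_S (hK : G.IsKPFamily P S T) {z y x : Λ} (f : y ⟶ x) (g : z ⟶ y) :
    S ⟨y, x, f⟩ * S ⟨z, y, g⟩ = S ⟨z, x, g ≫ f⟩ := by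
  by_cases hf : G.degree f = 0
  · obtain ⟨w, hw⟩ := G.eq_id_of_d_eq_zero ⟨y, x, f⟩ hf
    cases hw
    rw [hK.S_id, Category.comp_id]
    exact hK.P_mul_S ⟨z, y, g⟩
  by_cases hg : G.degree g = 0
  · obtain ⟨w, hw⟩ := G.eq_id_of_d_eq_zero ⟨z, y, g⟩ hg
    cases hw
    rw [hK.S_id, Category.id_comp]
    exact hK.S_mul_P ⟨z, x, f⟩
  exact hK _ _ (.kp2_path f g hf hg)

theorem T_mul_T (hK : G.IsKPFamily P S T) {z y x : Λ} (f : y ⟶ x) (g : z ⟶ y) :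
    T ⟨z, y, g⟩ * T ⟨y, x, f⟩ = T ⟨z, x, g ≫ f⟩ := by
  by_cases hf : G.degree f = 0
  · obtain ⟨w, hw⟩ := G.eq_id_of_d_eq_zero ⟨y, x, f⟩ hf
    cases hw
    rw [hK.T_id, Category.comp_id]
    exact hK.T_mul_P ⟨z, y, g⟩
  by_cases hg : G.degree g = 0
  · obtain ⟨w, hw⟩ := G.eq_id_of_d_eq_zero ⟨z, y, g⟩ hg
    cases hw
    rw [hK.T_id, Category.id_comp]
    exact hK.P_mul_T ⟨z, x, f⟩
  exact hK _ _ (.kp2_ghost f g hf hg)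

theorem S_mul_S_of_ne (hK : G.IsKPFamily P S T) {p q : Path Λ} (h : p.s ≠ q.r) :
    S p * S q = 0 := by
  rw [← hK.S_mul_P p, ← hK.P_mul_S q, mul_assoc, ← mul_assoc (P p.s), hK.P_mul_P_of_ne h, zero_mul,
    mul_zero]

theorem T_mul_T_of_ne (hK : G.IsKPFamily P S T) {p q : Path Λ} (h : p.r ≠ q.s) :
    T p * T q = 0 := by
  rw [← hK.T_mul_P p, ← hK.P_mul_T q, mul_assoc, ← mul_assoc (P p.r), hK.P_mul_P_of_ne h, zero_mul,
    mul_zero]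

theorem T_mul_S_of_range_ne (hK : G.IsKPFamily P S T) {p q : Path Λ} (h : p.r ≠ q.r) :
    T p * S q = 0 := by
  rw [← hK.T_mul_P p, ← hK.P_mul_S q, mul_assoc, ← mul_assoc (P p.r), hK.P_mul_P_of_ne h, zero_mul,
    mul_zero]

theorem T_mul_S_self (hK : G.IsKPFamily P S T) (p : Path Λ) : T p * S p = P p.s := by
  by_cases h : G.d p = 0
  · obtain ⟨x, rfl⟩ := G.eq_id_of_d_eq_zero p h
    rw [hK.S_id, hK.T_id, hK.P_mul_P]
  · exact hK _ _ (.kp3_eq _ h p (G.mem_pathsLE_d p))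

theorem T_mul_S_of_ne (hK : G.IsKPFamily P S T) {n : Fin k → ℕ} {p q : Path Λ}
    (hp : p ∈ G.pathsLE n) (hq : q ∈ G.pathsLE n) (h : p ≠ q) : T p * S q = 0 := by
  by_cases hn : n = 0
  · subst hn
    obtain ⟨x, rfl⟩ := G.eq_id_of_d_eq_zero p (le_antisymm hp.1 zero_le)
    obtain ⟨y, rfl⟩ := G.eq_id_of_d_eq_zero q (le_antisymm hq.1 zero_le)
    rw [hK.S_id, hK.T_id, hK.P_mul_P_of_ne]
    rintro rfl
    exact h rfl
  · exact hK _ _ (.kp3_ne n hn p q hp hq h)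

theorem P_eq_sum (hK : G.IsKPFamily P S T) (x : Λ) (n : Fin k → ℕ) {F : Finset (Path Λ)}
    (hF : ∀ p, p ∈ F ↔ p ∈ G.pathsLE n ∧ p.r = x) : P x = ∑ p ∈ F, S p * T p := by
  by_cases hn : n = 0
  · subst hn
    have : F = {⟨x, x, 𝟙 x⟩} := by
      ext p
      rw [hF, Finset.mem_singleton]
      constructor
      · rintro ⟨hp, rfl⟩
        obtain ⟨x, rfl⟩ := G.eq_id_of_d_eq_zero p (le_antisymm hp.1 zero_le)
        rfl
      · rintro rfl
        have h := G.mem_pathsLE_d ⟨x, x, 𝟙 x⟩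
        rw [show G.d ⟨x, x, 𝟙 x⟩ = 0 from G.degree_id x] at h
        exact ⟨h, rfl⟩
    rw [this, Finset.sum_singleton, hK.S_id, hK.T_id, hK.P_mul_P]
  · exact hK _ _ (.kp4 x n hn F hF)

theorem map {B : Type z} [NonUnitalSemiring B] (hK : G.IsKPFamily P S T) (φ : A →ₙ+* B) :
    G.IsKPFamily (φ ∘ P) (φ ∘ S) (φ ∘ T) := by
  intro a b h
  cases h
  case path_vertex x => exact congrArg φ (hK _ _ (.path_vertex x))
  case ghost_vertex x => exact congrArg φ (hK _ _ (.ghost_vertex x))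
  case kp1_idem x => exact (map_mul φ _ _).symm.trans (congrArg φ (hK _ _ (.kp1_idem x)))
  case kp1_orth x y h =>
    exact (map_mul φ _ _).symm.trans ((congrArg φ (hK _ _ (.kp1_orth x y h))).trans (map_zero φ))
  case kp2_path f g hf hg =>
    exact (map_mul φ _ _).symm.trans (congrArg φ (hK _ _ (.kp2_path f g hf hg)))
  case kp2_ghost f g hf hg =>
    exact (map_mul φ _ _).symm.trans (congrArg φ (hK _ _ (.kp2_ghost f g hf hg)))
  case kp2_range_path p hp =>
    exact (map_mul φ _ _).symm.trans (congrArg φ (hK _ _ (.kp2_range_path p hp)))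
  case kp2_path_source p hp =>
    exact (map_mul φ _ _).symm.trans (congrArg φ (hK _ _ (.kp2_path_source p hp)))
  case kp2_source_ghost p hp =>
    exact (map_mul φ _ _).symm.trans (congrArg φ (hK _ _ (.kp2_source_ghost p hp)))
  case kp2_ghost_range p hp =>
    exact (map_mul φ _ _).symm.trans (congrArg φ (hK _ _ (.kp2_ghost_range p hp)))
  case kp3_eq n hn p hp =>
    exact (map_mul φ _ _).symm.trans (congrArg φ (hK _ _ (.kp3_eq n hn p hp)))
  case kp3_ne n hn p q hp hq h =>
    exact (map_mul φ _ _).symm.trans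
      ((congrArg φ (hK _ _ (.kp3_ne n hn p q hp hq h))).trans (map_zero φ))
  case kp4 x n hn F hF =>
    refine (congrArg φ (hK _ _ (.kp4 x n hn F hF))).trans ((map_sum φ _ _).trans ?_)
    exact Finset.sum_congr rfl fun p _ => map_mul φ _ _

variable (R : Type z) [CommRing R] [Module R A]

/-- Products `S_f T_g` are spanned by products `S_p T_q` with `q` in a prescribed `Λ^{≤ n}`. -/
theorem S_mul_T_mem_span (hK : G.IsKPFamily P S T) (hrow : G.RowFinite) {y x x' : Λ} (f : y ⟶ x)
    (f' : y ⟶ x') {m n : Fin k → ℕ} (hf' : (⟨y, x', f'⟩ : Path Λ) ∈ G.pathsLE m) :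
    S ⟨y, x, f⟩ * T ⟨y, x', f'⟩ ∈ Submodule.span R
      {a | ∃ (z : Λ) (g : z ⟶ y), (⟨z, x', g ≫ f'⟩ : Path Λ) ∈ G.pathsLE (m + n) ∧
        a = S ⟨z, x, g ≫ f⟩ * T ⟨z, x', g ≫ f'⟩} := by
  obtain ⟨F, hF⟩ := hrow.exists_finset y n
  have h1 : S ⟨y, x, f⟩ * T ⟨y, x', f'⟩ = ∑ p ∈ F, S ⟨y, x, f⟩ * (S p * T p) * T ⟨y, x', f'⟩ := by
    rw [← Finset.sum_mul, ← Finset.mul_sum, ← hK.P_eq_sum y n hF, mul_assoc,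
      hK.P_mul_T ⟨y, x', f'⟩]
  rw [h1]
  refine Submodule.sum_mem _ fun p hp => ?_
  obtain ⟨z, y', g⟩ := p
  obtain ⟨hp, rfl⟩ := (hF _).1 hp
  refine Submodule.subset_span ⟨z, g, comp_mem_pathsLE hf' hp, ?_⟩
  rw [← mul_assoc, hK.S_mul_S, mul_assoc, hK.T_mul_T]

/-- Products `T_f S_g` are spanned by the products `S_p T_q`. -/
theorem T_mul_S_mem_span (hK : G.IsKPFamily P S T) (hrow : G.RowFinite) (f g : Path Λ) :
    T f * S g ∈ Submodule.span R {a | ∃ p q : Path Λ, p.s = q.s ∧ a = S p * T q} := by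
  obtain ⟨y, x, f⟩ := f
  obtain ⟨z, x', g⟩ := g
  by_cases hx : x = x'
  swap
  · rw [hK.T_mul_S_of_range_ne hx]
    exact zero_mem _
  subst hx
  -- The degrees are crossed on purpose: extending `f` by `Λ^{≤ d(g)}` and `g` by `Λ^{≤ d(f)}` puts
  -- both in `Λ^{≤ d(f) + d(g)}`, where (KP3) applies.
  obtain ⟨F, hF⟩ := hrow.exists_finset y (G.degree g)
  obtain ⟨F', hF'⟩ := hrow.exists_finset z (G.degree f)
  have h1 : T ⟨y, x, f⟩ = ∑ p ∈ F, S p * (T p * T ⟨y, x, f⟩) := by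
    simp_rw [← mul_assoc]
    rw [← Finset.sum_mul, ← hK.P_eq_sum y _ hF, hK.P_mul_T ⟨y, x, f⟩]
  have h2 : S ⟨z, x, g⟩ = ∑ q ∈ F', S ⟨z, x, g⟩ * S q * T q := by
    simp_rw [mul_assoc]
    rw [← Finset.mul_sum, ← hK.P_eq_sum z _ hF', hK.S_mul_P ⟨z, x, g⟩]
  rw [h1, h2, Finset.sum_mul_sum]
  refine Submodule.sum_mem _ fun p hp => Submodule.sum_mem _ fun q hq => ?_
  obtain ⟨w, y', α⟩ := p
  obtain ⟨hp, rfl⟩ := (hF _).1 hp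
  obtain ⟨w', z', β⟩ := q
  obtain ⟨hq, rfl⟩ := (hF' _).1 hq
  rw [hK.T_mul_T, hK.S_mul_S, mul_assoc, ← mul_assoc (T _)]
  have h3 := comp_mem_pathsLE (G.mem_pathsLE_d ⟨y', x, f⟩) hp
  have h4 := comp_mem_pathsLE (G.mem_pathsLE_d ⟨z', x, g⟩) hq
  rw [add_comm] at h4
  by_cases h : (⟨w, x, α ≫ f⟩ : Path Λ) = ⟨w', x, β ≫ g⟩
  · obtain rfl : w = w' := congrArg Path.s h
    rw [h, hK.T_mul_S_self, hK.P_mul_T ⟨w, z', β⟩]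
    exact Submodule.subset_span ⟨⟨w, y', α⟩, ⟨w, z', β⟩, rfl, rfl⟩
  · rw [hK.T_mul_S_of_ne h3 h4 h, zero_mul, mul_zero]
    exact zero_mem _

/-- The span of the products `S_p T_q` is closed under multiplication. -/
theorem mul_mem_span [IsScalarTower R A A] [SMulCommClass R A A] (hK : G.IsKPFamily P S T)
    (hrow : G.RowFinite) {a b : A}
    (ha : a ∈ Submodule.span R {a | ∃ p q : Path Λ, p.s = q.s ∧ a = S p * T q})
    (hb : b ∈ Submodule.span R {a | ∃ p q : Path Λ, p.s = q.s ∧ a = S p * T q}) :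
    a * b ∈ Submodule.span R {a | ∃ p q : Path Λ, p.s = q.s ∧ a = S p * T q} := by
  have key : ∀ (p q : Path Λ), ∀ c ∈ Submodule.span R {a | ∃ p q : Path Λ, p.s = q.s ∧ a = S p * T q},
      S p * c * T q ∈ Submodule.span R {a | ∃ p q : Path Λ, p.s = q.s ∧ a = S p * T q} := by
    intro p q c hc
    induction hc using Submodule.span_induction with
    | zero => simp
    | add a b _ _ h1 h2 => rw [mul_add, add_mul]; exact add_mem h1 h2
    | smul r a _ h => rw [mul_smul_comm, smul_mul_assoc]; exact Submodule.smul_mem _ _ h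
    | mem c hc =>
      obtain ⟨⟨w, x, α⟩, ⟨w', y, β⟩, h, rfl⟩ := hc
      obtain rfl : w = w' := h
      obtain ⟨x', x'', f⟩ := p
      obtain ⟨y', y'', g⟩ := q
      rw [← mul_assoc, mul_assoc]
      by_cases hx : x' = x
      · subst hx
        by_cases hy : y = y'
        · subst hy
          rw [hK.S_mul_S, hK.T_mul_T]
          exact Submodule.subset_span ⟨⟨w, x'', α ≫ f⟩, ⟨w, y'', β ≫ g⟩, rfl, rfl⟩
        · rw [hK.T_mul_T_of_ne hy, mul_zero]
          exact zero_mem _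
      · rw [hK.S_mul_S_of_ne hx, zero_mul]
        exact zero_mem _
  induction ha using Submodule.span_induction with
  | zero => simp
  | add a b _ _ h1 h2 => rw [add_mul]; exact add_mem h1 h2
  | smul r a _ h => rw [smul_mul_assoc]; exact Submodule.smul_mem _ _ h
  | mem a ha =>
    obtain ⟨p, q, -, rfl⟩ := ha
    induction hb using Submodule.span_induction with
    | zero => simp
    | add a b _ _ h1 h2 => rw [mul_add]; exact add_mem h1 h2
    | smul r a _ h => rw [mul_smul_comm]; exact Submodule.smul_mem _ _ h
    | mem b hb =>
      obtain ⟨p', q', -, rfl⟩ := hb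
      rw [mul_assoc, ← mul_assoc (T q), ← mul_assoc]
      exact key _ _ _ (hK.T_mul_S_mem_span R hrow _ _)

end IsKPFamily

/-! ### Homogeneous elements and their compression to vertices. -/

/-- The degree of a path, as an element of `ℤ^k`. -/
def intDegree (G : HigherRankGraph k Λ) (p : Path Λ) : Fin k → ℤ := fun i => G.d p i

theorem intDegree_comp {z y x : Λ} (g : z ⟶ y) (f : y ⟶ x) :
    G.intDegree ⟨z, x, g ≫ f⟩ = G.intDegree ⟨y, x, f⟩ + G.intDegree ⟨z, y, g⟩ := by
  funext i
  have := congrFun (G.degree_comp g f) i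
  simp [intDegree, d, this]

namespace IsKPFamily

variable {A : Type w} [NonUnitalSemiring A] {P : Λ → A} {S T : Path Λ → A}
variable (R : Type z) [CommRing R] [Module R A]

/-- A homogeneous element is a combination of products `S_p T_q` with all `q` in one `Λ^{≤ n}`. -/
theorem exists_mem_span_pathsLE (hK : G.IsKPFamily P S T) (hrow : G.RowFinite) {g : Fin k → ℤ}
    {a : A} (ha : a ∈ Submodule.span R {a | ∃ p q : Path Λ, p.s = q.s ∧
      G.intDegree p - G.intDegree q = g ∧ a = S p * T q}) :
    ∃ n, a ∈ Submodule.span R ((fun t : Path Λ × Path Λ => S t.1 * T t.2) ''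
      {t | t.1.s = t.2.s ∧ G.intDegree t.1 - G.intDegree t.2 = g ∧ t.2 ∈ G.pathsLE n}) := by
  -- Extending both paths of a product by the same path keeps the degree difference, so summands
  -- with bounds `m` and `n` both reach `m + n`.
  have mono : ∀ m n : Fin k → ℕ, Submodule.span R ((fun t : Path Λ × Path Λ => S t.1 * T t.2) ''
      {t | t.1.s = t.2.s ∧ G.intDegree t.1 - G.intDegree t.2 = g ∧ t.2 ∈ G.pathsLE m}) ≤
      Submodule.span R ((fun t : Path Λ × Path Λ => S t.1 * T t.2) ''
      {t | t.1.s = t.2.s ∧ G.intDegree t.1 - G.intDegree t.2 = g ∧ t.2 ∈ G.pathsLE (m + n)}) := by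
    intro m n
    rw [Submodule.span_le]
    rintro _ ⟨⟨⟨y, x, f⟩, ⟨y', x', f'⟩⟩, ⟨h1, h2, h3⟩, rfl⟩
    obtain rfl : y = y' := h1
    refine Submodule.span_mono ?_ (hK.S_mul_T_mem_span R hrow f f' (n := n) h3)
    rintro _ ⟨z, h, h4, rfl⟩
    refine ⟨(⟨z, x, h ≫ f⟩, ⟨z, x', h ≫ f'⟩), ⟨rfl, ?_, h4⟩, rfl⟩
    rw [← h2]
    dsimp only
    rw [intDegree_comp, intDegree_comp]
    abel
  induction ha using Submodule.span_induction with
  | zero => exact ⟨0, zero_mem _⟩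
  | add a b _ _ h1 h2 =>
    obtain ⟨m, h1⟩ := h1
    obtain ⟨n, h2⟩ := h2
    refine ⟨m + n, add_mem (mono m n h1) ?_⟩
    rw [add_comm m n]
    exact mono n m h2
  | smul r a _ h =>
    obtain ⟨n, h⟩ := h
    exact ⟨n, Submodule.smul_mem _ _ h⟩
  | mem a ha =>
    obtain ⟨p, q, h1, h2, rfl⟩ := ha
    exact ⟨G.d q, Submodule.subset_span ⟨(p, q), ⟨h1, h2, G.mem_pathsLE_d q⟩, rfl⟩⟩

/-- A nonzero homogeneous element can be compressed to a nonzero multiple of a vertex. -/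
theorem exists_compression [IsScalarTower R A A] [SMulCommClass R A A] (hK : G.IsKPFamily P S T)
    (hrow : G.RowFinite) {g : Fin k → ℤ} {a : A}
    (ha : a ∈ Submodule.span R {a | ∃ p q : Path Λ, p.s = q.s ∧
      G.intDegree p - G.intDegree q = g ∧ a = S p * T q}) (ha0 : a ≠ 0) :
    ∃ (p q : Path Λ) (r : R), p.s = q.s ∧ T p * a * S q = r • P p.s ∧ r • P p.s ≠ 0 := by
  obtain ⟨n, ha⟩ := hK.exists_mem_span_pathsLE R hrow ha
  obtain ⟨l, hl, rfl⟩ := (Finsupp.mem_span_image_iff_linearCombination R).1 ha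
  rw [Finsupp.mem_supported] at hl
  by_contra! hcon
  -- If every compression vanished, each coefficient would kill its source vertex, and hence each
  -- term of `a` would be zero.
  have key : ∀ t ∈ l.support, l t • P t.1.s = 0 := by
    rintro ⟨p, q⟩ ht
    obtain ⟨h1, h2, h3⟩ := hl ht
    refine hcon p q (l (p, q)) h1 ?_
    rw [Finsupp.linearCombination_apply, Finsupp.sum, Finset.mul_sum, Finset.sum_mul,
      Finset.sum_eq_single_of_mem _ ht]
    · rw [mul_smul_comm, smul_mul_assoc, ← mul_assoc, hK.T_mul_S_self, mul_assoc,
        hK.T_mul_S_self, ← h1, hK.P_mul_P]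
    · rintro ⟨p', q'⟩ ht' hne
      obtain ⟨h1', h2', h3'⟩ := hl ht'
      rw [mul_smul_comm, smul_mul_assoc, ← mul_assoc, mul_assoc]
      -- Distinct `q`, `q'` are separated by (KP3) in `Λ^{≤ n}`. If they agree, homogeneity forces
      -- `d(p') = d(p)`, and (KP3) in that degree separates `p` from `p'`.
      by_cases hq : q' = q
      · subst hq
        have hd : G.d p' = G.d p := by
          have h4 := sub_left_inj.1 (h2'.trans h2.symm)
          funext i
          exact Int.ofNat.inj (congrFun h4 i)
        have hp : p ≠ p' := by
          rintro rfl
          exact hne rfl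
        rw [hK.T_mul_S_of_ne (G.mem_pathsLE_d p) (hd ▸ G.mem_pathsLE_d p') hp, zero_mul, smul_zero]
      · rw [hK.T_mul_S_of_ne h3' h3 hq, mul_zero, smul_zero]
  refine ha0 ?_
  rw [Finsupp.linearCombination_apply]
  refine Finset.sum_eq_zero fun t ht => ?_
  dsimp only
  rw [← hK.S_mul_P t.1, ← smul_mul_assoc, ← mul_smul_comm, key t ht, mul_zero, zero_mul]

end IsKPFamily

end HigherRankGraph

/-! ### Consequences of primeness for rings without unit. -/

namespace IsPrimeRing

variable {A : Type w} [NonUnitalRing A]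

/-- Take `J = {y | a A y = 0}`, which contains `b`, and let `I` be its left annihilator. Idempotence
replaces the missing unit: `a y = a a y = 0` puts `a` in `I`. -/
theorem eq_zero_or_eq_zero (h : IsPrimeRing A) {a b : A} (ha : a * a = a)
    (hab : ∀ c, a * c * b = 0) : a = 0 ∨ b = 0 := by
  let J : TwoSidedIdeal A := TwoSidedIdeal.mk' {y | ∀ c, a * c * y = 0}
    (fun c => mul_zero _)
    (fun {x y} hx hy c => by rw [mul_add, hx, hy, add_zero])
    (fun {x} hx c => by rw [mul_neg, hx, neg_zero])
    (fun {x y} hy c => by rw [← mul_assoc, mul_assoc _ c x, hy])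
    (fun {x y} hx c => by rw [← mul_assoc, hx, zero_mul])
  let I : TwoSidedIdeal A := TwoSidedIdeal.mk' {x | ∀ y ∈ J, x * y = 0}
    (fun y _ => zero_mul y)
    (fun {x x'} hx hx' y hy => by rw [add_mul, hx y hy, hx' y hy, add_zero])
    (fun {x} hx y hy => by rw [neg_mul, hx y hy, neg_zero])
    (fun {c x} hx y hy => by rw [mul_assoc, hx y hy, mul_zero])
    (fun {x c} hx y hy => by rw [mul_assoc, hx _ (J.mul_mem_left _ _ hy)])
  have haI : a ∈ I := (TwoSidedIdeal.mem_mk' ..).2 fun y hy => by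
    have h1 := (TwoSidedIdeal.mem_mk' ..).1 hy a
    rwa [ha] at h1
  have hbJ : b ∈ J := (TwoSidedIdeal.mem_mk' ..).2 hab
  refine (h.2 I J fun x hx y hy => (TwoSidedIdeal.mem_mk' ..).1 hx y hy).imp (fun hI => ?_)
    fun hJ => ?_
  · rwa [hI, TwoSidedIdeal.mem_bot] at haI
  · rwa [hJ, TwoSidedIdeal.mem_bot] at hbJ

/-- If `r s = 0`, the ideals `r A` and `s A` have product zero, and faithfulness turns the vanishing
of one of them into `r = 0` or `s = 0`. -/
theorem isDomain {R : Type z} [CommRing R] [Module R A] [IsScalarTower R A A] [SMulCommClass R A A]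
    (h : IsPrimeRing A) (hA : ∀ r : R, (∀ a : A, r • a = 0) → r = 0) : IsDomain R := by
  have hnt : Nontrivial R := by
    have := h.1
    exact Module.nontrivial R A
  let I : R → TwoSidedIdeal A := fun r => TwoSidedIdeal.mk' (Set.range fun a => r • a)
    ⟨0, smul_zero r⟩
    (by rintro _ _ ⟨a, rfl⟩ ⟨b, rfl⟩; exact ⟨a + b, smul_add r a b⟩)
    (by rintro _ ⟨a, rfl⟩; exact ⟨-a, smul_neg r a⟩)
    (by rintro c _ ⟨a, rfl⟩; exact ⟨c * a, (mul_smul_comm r c a).symm⟩)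
    (by rintro _ c ⟨a, rfl⟩; exact ⟨a * c, (smul_mul_assoc r a c).symm⟩)
  have hI : ∀ r, I r = ⊥ → r = 0 := by
    refine fun r hr => hA r fun a => ?_
    have h1 : r • a ∈ I r := (TwoSidedIdeal.mem_mk' ..).2 ⟨_, rfl⟩
    rwa [hr, TwoSidedIdeal.mem_bot] at h1
  have : NoZeroDivisors R := ⟨fun {r s} hrs => by
    refine (h.2 (I r) (I s) fun a ha b hb => ?_).imp (hI r) (hI s)
    obtain ⟨a, rfl⟩ := (TwoSidedIdeal.mem_mk' ..).1 ha
    obtain ⟨b, rfl⟩ := (TwoSidedIdeal.mem_mk' ..).1 hb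
    dsimp only
    rw [smul_mul_assoc, mul_smul_comm, smul_smul, hrs, zero_smul]⟩
  exact NoZeroDivisors.to_isDomain R

end IsPrimeRing

/-! ### The `ℤ^k`-grading and reduction to homogeneous elements. -/

namespace HigherRankGraph

variable {k : ℕ} {Λ : Type u} [Category.{v} Λ] {G : HigherRankGraph k Λ}

namespace IsKPFamily

/-- Attaching degrees to a Kumjian-Pask family yields a family in the group ring of `ℤ^k`. -/
theorem single {A : Type w} [Semiring A] {P : Λ → A} {S T : Path Λ → A} (hK : G.IsKPFamily P S T) :
    G.IsKPFamily (fun x => AddMonoidAlgebra.single (0 : Fin k → ℤ) (P x))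
      (fun p => AddMonoidAlgebra.single (G.intDegree p) (S p))
      (fun p => AddMonoidAlgebra.single (-G.intDegree p) (T p)) := by
  have hid : ∀ x : Λ, G.intDegree ⟨x, x, 𝟙 x⟩ = 0 := fun x => by
    funext i
    simp [intDegree, d, G.degree_id]
  intro a b h
  cases h
  case path_vertex x => rw [hid, hK.S_id]
  case ghost_vertex x => rw [hid, hK.T_id, neg_zero]
  case kp1_idem x => rw [AddMonoidAlgebra.single_mul_single, hK.P_mul_P, add_zero]
  case kp1_orth x y h =>
    rw [AddMonoidAlgebra.single_mul_single, hK.P_mul_P_of_ne h, AddMonoidAlgebra.single_zero]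
  case kp2_path f g hf hg =>
    rw [AddMonoidAlgebra.single_mul_single, hK.S_mul_S, intDegree_comp]
  case kp2_ghost f g hf hg =>
    rw [AddMonoidAlgebra.single_mul_single, hK.T_mul_T, intDegree_comp, neg_add_rev]
  case kp2_range_path p hp => rw [AddMonoidAlgebra.single_mul_single, hK.P_mul_S, zero_add]
  case kp2_path_source p hp => rw [AddMonoidAlgebra.single_mul_single, hK.S_mul_P, add_zero]
  case kp2_source_ghost p hp => rw [AddMonoidAlgebra.single_mul_single, hK.P_mul_T, zero_add]
  case kp2_ghost_range p hp => rw [AddMonoidAlgebra.single_mul_single, hK.T_mul_P, add_zero]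
  case kp3_eq n hn p hp =>
    rw [AddMonoidAlgebra.single_mul_single, hK.T_mul_S_self, neg_add_cancel]
  case kp3_ne n hn p q hp hq h =>
    rw [AddMonoidAlgebra.single_mul_single, hK.T_mul_S_of_ne hp hq h, AddMonoidAlgebra.single_zero]
  case kp4 x n hn F hF =>
    simp only [AddMonoidAlgebra.single_mul_single, add_neg_cancel]
    rw [hK.P_eq_sum x n hF]
    exact map_sum (AddMonoidAlgebra.singleAddHom (0 : Fin k → ℤ)) _ _

end IsKPFamily

namespace KP

variable (R : Type w) [CommRing R]

theorem isKPFamily_gen : G.IsKPFamily (A := G.UnitalKP R) (fun x => G.gen R (.vertex x))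
    (fun p => G.gen R (.path p)) (fun p => G.gen R (.ghost p)) :=
  (KP.isKPFamily G R).map (NonUnitalSubalgebraClass.subtype (G.KP R) : G.KP R →ₙ+* G.UnitalKP R)

/-- `KP_R(Λ)` is spanned by the products `s_p s_{q^*}`. -/
theorem mem_span (hrow : G.RowFinite) (a : G.KP R) :
    a ∈ Submodule.span R {a : G.KP R | ∃ p q : Path Λ, p.s = q.s ∧
      a = KP.of G R (.path p) * KP.of G R (.ghost q)} := by
  have hK := KP.isKPFamily G R
  have ha : a ∈ NonUnitalAlgebra.adjoin R (Set.range (KP.of G R)) := by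
    rw [KP.adjoin_eq_top]
    trivial
  induction ha using NonUnitalAlgebra.adjoin_induction with
  | add x y _ _ h1 h2 => exact add_mem h1 h2
  | zero => exact zero_mem _
  | mul x y _ _ h1 h2 => exact hK.mul_mem_span R hrow h1 h2
  | smul r x _ h => exact Submodule.smul_mem _ _ h
  | mem x hx =>
    obtain ⟨g, rfl⟩ := hx
    refine Submodule.subset_span ?_
    cases g with
    | vertex x =>
      refine ⟨⟨x, x, 𝟙 x⟩, ⟨x, x, 𝟙 x⟩, rfl, ?_⟩
      rw [hK.S_id, hK.T_id, hK.P_mul_P]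
    | path p =>
      refine ⟨p, ⟨p.s, p.s, 𝟙 p.s⟩, rfl, ?_⟩
      rw [hK.T_id, hK.S_mul_P]
    | ghost p =>
      refine ⟨⟨p.s, p.s, 𝟙 p.s⟩, p, rfl, ?_⟩
      rw [hK.S_id, hK.P_mul_T]

/-- The `ℤ^k`-grading of `KP_R(Λ)`, as a coaction of the group ring of `ℤ^k`. -/
theorem exists_grading (hrow : G.RowFinite) :
    ∃ φ : G.KP R →ₙₐ[R] AddMonoidAlgebra (G.UnitalKP R) (Fin k → ℤ),
      (∀ p q, φ (KP.of G R (.path p) * KP.of G R (.ghost q)) = AddMonoidAlgebra.single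
        (G.intDegree p - G.intDegree q) (G.gen R (.path p) * G.gen R (.ghost q))) ∧
      (∀ a g, (φ a).coeff g ∈ Submodule.span R {a | ∃ p q : Path Λ, p.s = q.s ∧
        G.intDegree p - G.intDegree q = g ∧ a = G.gen R (.path p) * G.gen R (.ghost q)}) ∧
      ∀ a, φ a = 0 → a = 0 := by
  classical
  obtain ⟨φ, -, hS, hT⟩ := KP.exists_lift G R
    (A := AddMonoidAlgebra (G.UnitalKP R) (Fin k → ℤ)) _ _ _ (isKPFamily_gen (G := G) R).single
  have hφ : ∀ p q, φ (KP.of G R (.path p) * KP.of G R (.ghost q)) = AddMonoidAlgebra.single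
      (G.intDegree p - G.intDegree q) (G.gen R (.path p) * G.gen R (.ghost q)) := fun p q => by
    rw [map_mul, hS, hT, AddMonoidAlgebra.single_mul_single, sub_eq_add_neg]
  refine ⟨φ, hφ, fun a g => ?_, fun a ha => ?_⟩
  · have ha := mem_span R hrow a
    induction ha using Submodule.span_induction with
    | zero => simp
    | add a b _ _ h1 h2 =>
      rw [map_add, AddMonoidAlgebra.coeff_add, Finsupp.add_apply]
      exact add_mem h1 h2
    | smul r a _ h =>
      rw [map_smul, AddMonoidAlgebra.coeff_smul_apply]
      exact Submodule.smul_mem _ _ h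
    | mem a ha =>
      obtain ⟨p, q, hpq, rfl⟩ := ha
      rw [hφ, AddMonoidAlgebra.coeff_single, Finsupp.single_apply]
      split_ifs with hg
      · exact Submodule.subset_span ⟨p, q, hpq, hg, rfl⟩
      · exact zero_mem _
  -- Adding up all homogeneous components recovers `a`, so `φ` is injective.
  · have key : ((φ a).coeff.sum fun _ b => b) = (a : G.UnitalKP R) := by
      have ha := mem_span R hrow a
      clear * - ha hφ
      induction ha using Submodule.span_induction with
      | zero => simp
      | add a b _ _ h1 h2 =>
        rw [map_add, AddMonoidAlgebra.coeff_add,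
          Finsupp.sum_add_index' (fun _ => rfl) (fun _ _ _ => rfl), h1, h2]
        rfl
      | smul r a _ h =>
        rw [map_smul, AddMonoidAlgebra.coeff_smul, Finsupp.sum_smul_index' (fun _ => rfl),
          ← Finsupp.smul_sum, h]
        rfl
      | mem a ha =>
        obtain ⟨p, q, hpq, rfl⟩ := ha
        rw [hφ, AddMonoidAlgebra.coeff_single, Finsupp.sum_single_index rfl]
        rfl
    rw [ha, AddMonoidAlgebra.coeff_zero, Finsupp.sum_zero_index] at key
    exact Subtype.ext key.symm

theorem smul_vertex_ne_zero (hconv : G.LocallyConvex) {r : R} (hr : r ≠ 0) (x : Λ) :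
    r • G.gen R (.vertex x) ≠ 0 := fun h =>
  hr (eq_zero_of_smul_vertex_eq_zero hconv R (x := x) (Subtype.ext h))

variable {R}

/-- If `a KP_R(Λ) b = 0` with `a`, `b` nonzero, then the same holds for suitable homogeneous
components. -/
theorem exists_homogeneous (hrow : G.RowFinite) {a b : G.KP R} (ha : a ≠ 0) (hb : b ≠ 0)
    (hab : ∀ x, a * x * b = 0) : ∃ (g h : Fin k → ℤ) (a' b' : G.UnitalKP R), a' ≠ 0 ∧ b' ≠ 0 ∧
      a' ∈ Submodule.span R {a | ∃ p q : Path Λ, p.s = q.s ∧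
        G.intDegree p - G.intDegree q = g ∧ a = G.gen R (.path p) * G.gen R (.ghost q)} ∧
      b' ∈ Submodule.span R {a | ∃ p q : Path Λ, p.s = q.s ∧
        G.intDegree p - G.intDegree q = h ∧ a = G.gen R (.path p) * G.gen R (.ghost q)} ∧
      ∀ p q, a' * (G.gen R (.path p) * G.gen R (.ghost q)) * b' = 0 := by
  obtain ⟨φ, hφ, hmem, hinj⟩ := exists_grading (G := G) R hrow
  -- Choose degrees `g`, `h` whose sum arises from no other pair in the two supports. For `x` of
  -- degree `t`, the component of `a x b` in degree `g + t + h` is then a single product.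
  obtain ⟨g, hg, h, hh, hgh⟩ := UniqueSums.uniqueAdd_of_nonempty
    (Finsupp.support_nonempty_iff.2 fun h => ha (hinj a (AddMonoidAlgebra.coeff_eq_zero.1 h)))
    (Finsupp.support_nonempty_iff.2 fun h => hb (hinj b (AddMonoidAlgebra.coeff_eq_zero.1 h)))
  refine ⟨g, h, (φ a).coeff g, (φ b).coeff h, Finsupp.mem_support_iff.1 hg,
    Finsupp.mem_support_iff.1 hh, hmem a g, hmem b h, fun p q => ?_⟩
  have h1 := congrArg φ (hab (KP.of G R (.path p) * KP.of G R (.ghost q)))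
  rw [mul_assoc, map_mul, map_mul, hφ, map_zero] at h1
  set t := G.intDegree p - G.intDegree q
  set x := G.gen R (.path p) * G.gen R (.ghost q)
  -- Multiplication by `x` shifts degrees by `t` and can only shrink the support, so uniqueness of
  -- the sum persists.
  have h2 : UniqueAdd (φ a).coeff.support (AddMonoidAlgebra.single t x * φ b).coeff.support
      g (t + h) := by
    intro i j hi hj hij
    have h3 : -t + j ∈ (φ b).coeff.support := by
      rw [Finsupp.mem_support_iff, AddMonoidAlgebra.coeff_single_mul_apply] at hj
      exact Finsupp.mem_support_iff.2 (right_ne_zero_of_mul hj)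
    obtain ⟨rfl, h5⟩ := hgh hi h3 (by rw [← add_assoc, add_comm i, add_assoc, hij]; abel)
    exact ⟨rfl, add_left_cancel hij⟩
  have h3 := AddMonoidAlgebra.coeff_mul_add_of_uniqueAdd h2
  rw [h1, AddMonoidAlgebra.coeff_single_mul_apply, neg_add_cancel_left] at h3
  rw [mul_assoc, ← h3]
  rfl

/-! ### The two directions of the criterion. -/

theorem isPrimeRing [Nonempty Λ] [IsDomain R] (hrow : G.RowFinite) (hconv : G.LocallyConvex)
    (hMT : MT3 (Set.univ : Set Λ)) : IsPrimeRing (G.KP R) := by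
  refine ⟨?_, fun I J hIJ => ?_⟩
  · obtain ⟨x⟩ := ‹Nonempty Λ›
    refine ⟨⟨KP.of G R (.vertex x), 0, fun h => one_ne_zero (α := R) ?_⟩⟩
    exact eq_zero_of_smul_vertex_eq_zero hconv R (x := x) (by rw [h, smul_zero])
  by_contra! hne
  have hex : ∀ K : TwoSidedIdeal (G.KP R), K ≠ ⊥ → ∃ a ∈ K, a ≠ 0 := by
    intro K hK
    by_contra! h
    refine hK (TwoSidedIdeal.ext fun x => ⟨fun hx => ?_, fun hx => ?_⟩)
    · exact (TwoSidedIdeal.mem_bot _).2 (h x hx)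
    · rw [(TwoSidedIdeal.mem_bot _).1 hx]
      exact K.zero_mem
  obtain ⟨a, haI, ha⟩ := hex I hne.1
  obtain ⟨b, hbJ, hb⟩ := hex J hne.2
  obtain ⟨g, h, a', b', ha', hb', hag, hbh, hab⟩ := exists_homogeneous hrow ha hb
    fun x => hIJ _ (I.mul_mem_right _ _ haI) _ hbJ
  have hK := isKPFamily_gen (G := G) R
  obtain ⟨p, ⟨y, x, f⟩, r, h1, h2, h3⟩ := hK.exists_compression R hrow hag ha'
  obtain ⟨⟨y', x', f'⟩, q, r', -, h5, h6⟩ := hK.exists_compression R hrow hbh hb'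
  obtain ⟨z, -, ⟨α⟩, ⟨β⟩⟩ := hMT y trivial y' trivial
  have hr : r ≠ 0 := by rintro rfl; exact h3 (zero_smul _ _)
  have hr' : r' ≠ 0 := by rintro rfl; exact h6 (zero_smul _ _)
  rw [show p.s = y from h1] at h2
  refine smul_vertex_ne_zero R hconv (mul_ne_zero hr hr') z ?_
  have e1 := hK.P_mul_S ⟨z, y, α⟩
  have e2 := hK.T_mul_P ⟨z, y', β⟩
  have e3 := hK.S_mul_S f α
  have e4 := hK.T_mul_T f' β
  have e5 := hK.T_mul_S_self ⟨z, y, α⟩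
  have e6 := hK.T_mul_S_self ⟨z, y', β⟩
  have e7 := hK.P_mul_P z
  have e8 := hab ⟨z, x, α ≫ f⟩ ⟨z, x', β ≫ f'⟩
  dsimp only at e1 e2 e3 e4 e5 e6 e7 e8 h2 h5
  -- Both compressed vertices are joined through `z` by `s_α s_{β^*}`. Unfolding the compressions
  -- absorbs `α` and `β` into longer paths and exposes a factor of the form `a' (s s^*) b'`, which
  -- is zero.
  calc (r * r') • G.gen R (.vertex z)
      = G.gen R (.ghost ⟨z, y, α⟩) * ((r • G.gen R (.vertex y)) *
          (G.gen R (.path ⟨z, y, α⟩) * G.gen R (.ghost ⟨z, y', β⟩)) *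
          (r' • G.gen R (.vertex y'))) * G.gen R (.path ⟨z, y', β⟩) := by
        rw [smul_mul_assoc, mul_smul_comm, smul_mul_assoc, smul_smul, mul_smul_comm,
          smul_mul_assoc, mul_comm r', ← mul_assoc (G.gen R (.vertex y)), e1, mul_assoc (G.gen R (.path _)),
          e2, ← mul_assoc, e5, mul_assoc, e6, e7]
    _ = G.gen R (.ghost ⟨z, y, α⟩) * (G.gen R (.ghost p) * (a' *
          (G.gen R (.path ⟨z, x, α ≫ f⟩) * G.gen R (.ghost ⟨z, x', β ≫ f'⟩)) * b') *
          G.gen R (.path q)) * G.gen R (.path ⟨z, y', β⟩) := by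
        rw [← h2, ← h5, ← e3, ← e4]
        simp only [mul_assoc]
    _ = 0 := by rw [e8]; simp

theorem isDomain_of_isPrimeRing [Nonempty Λ] (hconv : G.LocallyConvex)
    (h : IsPrimeRing (G.KP R)) : IsDomain R := by
  obtain ⟨x⟩ := ‹Nonempty Λ›
  exact h.isDomain fun r hr =>
    eq_zero_of_smul_vertex_eq_zero hconv R (x := x) (hr (KP.of G R (.vertex x)))

/-- A spanning element `s_p s_{q^*}` survives between `p_x` and `p_y` only if `p` and `q` have
ranges `x` and `y`; their common source is then the required vertex. Otherwise `p_x KP p_y = 0` with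
both vertices nonzero. -/
theorem mt3_of_isPrimeRing (hrow : G.RowFinite) (hconv : G.LocallyConvex)
    (h : IsPrimeRing (G.KP R)) : MT3 (Set.univ : Set Λ) := by
  intro x _ y _
  have hK := KP.isKPFamily G R
  have hnt : Nontrivial R := by
    have := h.1
    exact Module.nontrivial R (G.KP R)
  have hne : ∀ v : Λ, KP.of G R (.vertex v) ≠ 0 := fun v hv =>
    one_ne_zero (eq_zero_of_smul_vertex_eq_zero hconv R (r := 1) (x := v) (by rw [hv, smul_zero]))
  by_contra hcon
  have hzero : ∀ c, KP.of G R (.vertex x) * c * KP.of G R (.vertex y) = 0 := by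
    intro c
    have hc := mem_span R hrow c
    induction hc using Submodule.span_induction with
    | zero => simp
    | add a b _ _ h1 h2 => rw [mul_add, add_mul, h1, h2, add_zero]
    | smul r a _ h => rw [mul_smul_comm, smul_mul_assoc, h, smul_zero]
    | mem c hc =>
      obtain ⟨⟨z, x', f⟩, ⟨z', y', g⟩, hz, rfl⟩ := hc
      obtain rfl : z = z' := hz
      rw [← hK.P_mul_S ⟨z, x', f⟩, ← hK.T_mul_P ⟨z, y', g⟩]
      dsimp only
      simp only [← mul_assoc]
      by_cases hx : x = x'
      · subst hx
        by_cases hy : y' = y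
        · subst hy
          exact absurd ⟨z, trivial, ⟨f⟩, ⟨g⟩⟩ hcon
        · rw [mul_assoc _ _ (KP.of G R (.vertex y)), hK.P_mul_P_of_ne hy, mul_zero]
      · rw [hK.P_mul_P_of_ne hx]
        simp only [zero_mul]
  exact (h.eq_zero_or_eq_zero (hK.P_mul_P x) hzero).elim (hne x) (hne y)

end KP

end HigherRankGraph

theorem theorem4p5 {k : ℕ} (hk : 0 < k) {Λ : Type u} [Category.{v} Λ] [Nonempty Λ]
    (G : HigherRankGraph k Λ) (hrow : G.RowFinite) (hconv : G.LocallyConvex)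
    (R : Type w) [CommRing R] :
    IsPrimeRing (G.KP R) ↔ IsDomain R ∧ HigherRankGraph.MT3 (Set.univ : Set Λ) :=
  ⟨fun h => ⟨HigherRankGraph.KP.isDomain_of_isPrimeRing hconv h,
    HigherRankGraph.KP.mt3_of_isPrimeRing hrow hconv h⟩,
  fun ⟨_, hMT⟩ => HigherRankGraph.KP.isPrimeRing hrow hconv hMT⟩
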